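/- For a finite graph $G$, let $\delta(G)$ denote its minimum degree, and let $r_g(G,\mathcal{H})$ denote the global resilience of $G$ with respect to Hamiltonicity, that is, the minimal $m$ for which there exists a subgraph $H\subseteq G$ with exactly $m$ edges such that $G\setminus H$ (the graph obtained from $G$ by deleting the edges of $H$) is not Hamiltonian. Let $p=p(n)\in[0,1]$ satisfy $np-\log n-\log\log n\to\infty$ as $n\to\infty$ (natural logarithms) and $p\le n^{-0.4}$ for all sufficiently large $n$, and let $G\sim G(n,p)$ be the binomial random graph on $n$ vertices, in which each pair of vertices is joined by an edge independently with probability $p$. Then with high probability $r_g(G,\mathcal{H})=\delta(G)-1$; that is, $$\lim_{n\to\infty}\mathbb{P}\big(r_g(G,\mathcal{H})=\delta(G)-1\big)=1 .$$ -/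

import Mathlib

open Filter Topology

namespace SimpleGraph

/-- The global resilience of a graph `G` with respect to a graph property `P`: the minimal `m` for
which there is a subgraph `H` of `G` with exactly `m` edges such that the graph `G \ H`, obtained
from `G` by deleting the edges of `H`, does not satisfy `P`. (Isolated vertices of `H` are
irrelevant, so `H` is taken on the whole vertex set of `G`.) -/
noncomputable def globalResilience {V : Type*} (G : SimpleGraph V) (P : SimpleGraph V → Prop) : ℕ :=
  sInf {m : ℕ | ∃ H : SimpleGraph V, H ≤ G ∧ H.edgeSet.ncard = m ∧ ¬ P (G \ H)}

open scoped Classical in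
/-- The minimum degree of a graph on a finite vertex set, with the decidability of adjacency
supplied classically. -/
noncomputable def minDeg {V : Type*} [Fintype V] (G : SimpleGraph V) : ℕ :=
  G.minDegree

end SimpleGraph

/-! Upper bound: deleting all but one edge at a vertex of minimum degree δ destroys every
Hamiltonian cycle. Lower bound: with high probability `G \ H` is Hamiltonian for all `H` with at
most δ - 2 edges simultaneously. There is no union bound over `H`: the randomness is confined to the
list of properties `IsResilientlyHamiltonian`, and from these the argument for an arbitrary `H` is
deterministic.

Inside `G \ H` lies a sparse spanning subgraph Γ that is still an expander
(`exists_sparse_subgraph`, `isExpander_of_small_of_large`). Only vertices of low degree threaten its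
expansion. Let k be a small multiple of np. If δ ≤ 2k, then `H` cannot spoil vertices of degree at
least 4k, and the others are pairwise at distance more than 4 in `G`
(`two_mul_card_le_extNbhd_of_far`). If δ > 2k, then `H` has too few edges to push more than C
vertices below degree k. Two such vertices have almost 2δ neighbours together, because codegrees are
small (here p ≤ n^(-0.4) enters), and `H` removes at most δ - 2 of them
(`two_mul_card_le_extNbhd_of_few`).

By Pósa rotations a non-Hamiltonian expander has at least n²/32 boosters
(`IsExpander.card_boosters`). In the random graph, every sparse Γ ⊆ G with that many boosters has at
least δ of them among the edges of `G` (`binomialRandom_real_few_boosters`). The union bound over Γ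
is affordable since Γ is sparse, and boosters of Γ are independent of the event Γ ⊆ G. So `H` misses
some booster, and adding at most n of them one by one yields a Hamiltonian cycle
(`isHamiltonian_of_boosters`). -/

set_option linter.unusedSectionVars false

/-! ### Pósa rotations and longest paths. -/

namespace SimpleGraph

variable {V : Type*} {G : SimpleGraph V}

/-- A path in `G`, given as the list of its vertices. -/
def IsPathList (G : SimpleGraph V) (l : List V) : Prop :=
  l.Nodup ∧ l.IsChain G.Adj

/-- The lists obtained from the path `l₀` by Pósa rotations that keep its first vertex. -/
inductive Rotates (G : SimpleGraph V) (l₀ : List V) : List V → Prop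
  | refl : Rotates G l₀ l₀
  | step (l₁ : List V) (a : V) (l₂ : List V) (u : V) :
      Rotates G l₀ (l₁ ++ a :: (l₂ ++ [u])) → G.Adj a u →
      Rotates G l₀ (l₁ ++ a :: u :: l₂.reverse)

/-- `u` is the last vertex of some rotation of `l₀`. -/
def IsRotEnd (G : SimpleGraph V) (l₀ : List V) (u : V) : Prop :=
  ∃ l, G.Rotates l₀ (l ++ [u])

lemma Rotates.perm {l₀ l : List V} (h : G.Rotates l₀ l) : l.Perm l₀ := by
  induction h with
  | refl => exact List.Perm.refl _
  | step l₁ a l₂ u _ _ ih =>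
    refine List.Perm.trans ?_ ih
    refine List.Perm.append_left _ (List.Perm.cons _ ?_)
    have := List.reverse_perm (l₂ ++ [u])
    simpa using this

lemma Rotates.head? {l₀ l : List V} (h : G.Rotates l₀ l) : l.head? = l₀.head? := by
  induction h with
  | refl => rfl
  | step l₁ a l₂ u _ _ ih => rw [← ih]; cases l₁ <;> simp

lemma isChain_rotate {R : V → V → Prop} (hR : ∀ a b, R a b → R b a) {l₁ l₂ : List V} {a u : V}
    (h : (l₁ ++ a :: (l₂ ++ [u])).IsChain R) (hau : R a u) :
    (l₁ ++ a :: u :: l₂.reverse).IsChain R := by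
  have h2 : (l₂ ++ [u]).IsChain R := by
    have : l₁ ++ a :: (l₂ ++ [u]) = (l₁ ++ [a]) ++ (l₂ ++ [u]) := by simp
    rw [this] at h
    exact h.right_of_append
  have h1 : (l₁ ++ [a]).IsChain R := by
    have : l₁ ++ a :: (l₂ ++ [u]) = (l₁ ++ [a]) ++ (l₂ ++ [u]) := by simp
    rw [this] at h
    exact h.left_of_append
  have h3 : (u :: l₂.reverse).IsChain R := by
    have : (l₂ ++ [u]).reverse.IsChain R := by
      rw [List.isChain_reverse]
      exact h2.imp fun a b hab => hR _ _ hab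
    simpa using this
  rw [List.isChain_append_cons_cons]
  exact ⟨h1, hau, h3⟩

lemma Rotates.isPathList {l₀ l : List V} (h : G.Rotates l₀ l) (h₀ : G.IsPathList l₀) :
    G.IsPathList l := by
  refine ⟨h.perm.nodup_iff.2 h₀.1, ?_⟩
  induction h with
  | refl => exact h₀.2
  | step l₁ a l₂ u _ hau ih => exact isChain_rotate (fun _ _ h => h.symm) ih hau

/-- A rotation deletes a path edge `ab` after which `b` is an end, and creates the edge `au` from a
former end `u`. If no end is next to `w` on the path, the deleted edge never meets `w`, and neither
does the new one, so the path edges at `w` survive all rotations. -/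
lemma Rotates.isChain_avoid {l₀ l : List V} (h : G.Rotates l₀ l) {w : V}
    (hw : ¬ G.IsRotEnd l₀ w)
    (h₀ : l₀.IsChain fun a b => (a = w → ¬ G.IsRotEnd l₀ b) ∧ (b = w → ¬ G.IsRotEnd l₀ a)) :
    l.IsChain fun a b => (a = w → ¬ G.IsRotEnd l₀ b) ∧ (b = w → ¬ G.IsRotEnd l₀ a) := by
  induction h with
  | refl => exact h₀
  | step l₁ a l₂ u hrot hau ih =>
    rcases l₂ with _ | ⟨b, l₃⟩
    · simpa using ih
    have hb : G.IsRotEnd l₀ b := by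
      refine ⟨l₁ ++ a :: u :: l₃.reverse, ?_⟩
      have := Rotates.step l₁ a (b :: l₃) u hrot hau
      simpa using this
    have hu : G.IsRotEnd l₀ u := by
      refine ⟨l₁ ++ a :: b :: l₃, ?_⟩
      simpa using hrot
    have haw : a ≠ w := by
      rintro rfl
      have := (List.isChain_append_cons_cons.1 ih).2.1.1 rfl
      exact this hb
    have huw : u ≠ w := by rintro rfl; exact hw hu
    exact isChain_rotate (fun x y hxy => ⟨hxy.2, hxy.1⟩) ih
      ⟨fun h => absurd h haw, fun h => absurd h huw⟩

/-- Rotating with the edge `uw` turns the successor of `w` into an end. Were both path neighbours of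
`w` in `l₀` non-ends, `w` would still have that successor's property by `Rotates.isChain_avoid`, a
contradiction. -/
lemma not_isChain_of_adj_rotEnd {l₀ l : List V} {u w : V} (h : G.Rotates l₀ (l ++ [u]))
    (huw : G.Adj u w) (hwl : w ∈ l ++ [u]) (hw : ¬ G.IsRotEnd l₀ w) :
    ¬ l₀.IsChain fun a b => (a = w → ¬ G.IsRotEnd l₀ b) ∧ (b = w → ¬ G.IsRotEnd l₀ a) := by
  intro h₀
  have hl := h.isChain_avoid hw h₀
  have hwl' : w ∈ l := by
    rcases List.mem_append.1 hwl with h | h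
    · exact h
    · exact absurd (List.mem_singleton.1 h).symm huw.ne
  obtain ⟨l₁, l₂, rfl⟩ := List.append_of_mem hwl'
  rcases l₂ with _ | ⟨b, l₃⟩
  · rw [List.append_assoc, List.singleton_append] at hl
    exact (List.isChain_append_cons_cons.1 hl).2.1.1 rfl ⟨_, h⟩
  · rw [List.append_assoc, List.cons_append, List.cons_append] at hl
    refine (List.isChain_append_cons_cons.1 hl).2.1.1 rfl ⟨l₁ ++ w :: u :: l₃.reverse, ?_⟩
    have := Rotates.step (G := G) (l₀ := l₀) l₁ w (b :: l₃) u (by simpa using h) huw.symm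
    simpa using this

variable [Fintype V] [DecidableEq V]

open scoped Classical in
/-- The external neighbourhood of a set of vertices. -/
noncomputable def extNbhd (G : SimpleGraph V) (S : Finset V) : Finset V :=
  Finset.univ.filter fun w => w ∉ S ∧ ∃ v ∈ S, G.Adj v w

lemma mem_extNbhd {S : Finset V} {w : V} :
    w ∈ G.extNbhd S ↔ w ∉ S ∧ ∃ v ∈ S, G.Adj v w := by
  simp [extNbhd]

open scoped Classical in
/-- The set of last vertices of rotations of `l₀`. -/
noncomputable def rotEnds (G : SimpleGraph V) (l₀ : List V) : Finset V :=
  Finset.univ.filter fun u => G.IsRotEnd l₀ u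

lemma mem_rotEnds {l₀ : List V} {u : V} : u ∈ G.rotEnds l₀ ↔ G.IsRotEnd l₀ u := by
  simp [rotEnds]

/-- Each element of `W` is the predecessor or the successor on the path of some element of `R`. The
last vertex `z` has no successor, which makes the inequality strict. -/
lemma card_filter_not_isChain_lt {l₀ : List V} (hn : l₀.Nodup) {R : Finset V}
    {z : V} (hz : z ∈ l₀.getLast?) (hzR : z ∈ R) (W : Finset V)
    (hW : ∀ w ∈ W, ¬ l₀.IsChain fun a b => (a = w → b ∉ R) ∧ (b = w → a ∉ R)) :
    W.card < 2 * R.card := by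
  -- Predecessor and successor maps. Their values at the ends of the path are junk, but only the
  -- covering of `W` by the images matters.
  set f : V → V := fun r => l₀.getD (l₀.idxOf r - 1) r
  set g : V → V := fun r => l₀.getD (l₀.idxOf r + 1) r
  have hsub : W ⊆ R.image f ∪ (R.erase z).image g := by
    intro w hw
    have := hW w hw
    rw [List.isChain_iff_getElem] at this
    push Not at this
    obtain ⟨i, hi, h⟩ := this
    rw [Finset.mem_union, Finset.mem_image, Finset.mem_image]
    by_cases h1 : l₀[i] = w → l₀[i + 1] ∉ R
    · obtain ⟨h2, h3⟩ := h h1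
      right
      refine ⟨l₀[i], Finset.mem_erase.2 ⟨?_, h3⟩, ?_⟩
      · intro hc
        rw [List.getLast?_eq_getElem?] at hz
        have hz' : l₀[l₀.length - 1]? = some z := hz
        rw [List.getElem?_eq_some_iff] at hz'
        obtain ⟨hlt, hz'⟩ := hz'
        rw [← hz'] at hc
        have := (hn.getElem_inj_iff).1 hc
        omega
      · simp only [g]
        rw [hn.idxOf_getElem, List.getD_eq_getElem _ _ hi]
        exact h2
    · push Not at h1
      left
      refine ⟨l₀[i + 1], h1.2, ?_⟩
      simp only [f]
      rw [hn.idxOf_getElem, Nat.add_sub_cancel, List.getD_eq_getElem _ _ (by omega)]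
      exact h1.1
  have h1 := Finset.card_le_card hsub
  have h2 := Finset.card_union_le (R.image f) ((R.erase z).image g)
  have h3 := Finset.card_image_le (s := R) (f := f)
  have h4 := Finset.card_image_le (s := R.erase z) (f := g)
  have h5 := Finset.card_erase_of_mem hzR
  have h6 := Finset.card_pos.2 ⟨z, hzR⟩
  omega

/-- A path with as many vertices as possible. -/
def IsLongest (G : SimpleGraph V) (l : List V) : Prop :=
  G.IsPathList l ∧ ∀ l', G.IsPathList l' → l'.length ≤ l.length

lemma IsPathList.reverse {l : List V} (h : G.IsPathList l) : G.IsPathList l.reverse :=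
  ⟨List.nodup_reverse.2 h.1, by
    rw [List.isChain_reverse]; exact h.2.imp fun _ _ h => h.symm⟩

lemma IsLongest.reverse {l : List V} (h : G.IsLongest l) : G.IsLongest l.reverse :=
  ⟨h.1.reverse, fun l' hl' => by simpa using h.2 l' hl'⟩

lemma IsLongest.rotates {l₀ l : List V} (h : G.IsLongest l₀) (hr : G.Rotates l₀ l) :
    G.IsLongest l :=
  ⟨hr.isPathList h.1, fun l' hl' => by rw [hr.perm.length_eq]; exact h.2 l' hl'⟩

lemma IsPathList.concat {l : List V} {u w : V} (h : G.IsPathList (l ++ [u])) (huw : G.Adj u w)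
    (hw : w ∉ l ++ [u]) : G.IsPathList (l ++ [u] ++ [w]) := by
  refine ⟨?_, ?_⟩
  · rw [List.nodup_append]
    refine ⟨h.1, by simp, ?_⟩
    rintro a ha b hb rfl
    rw [List.mem_singleton] at hb
    exact hw (hb ▸ ha)
  · rw [List.append_assoc, List.singleton_append, List.isChain_append_cons_cons]
    exact ⟨h.2, huw, by simp⟩

/-- Pósa's lemma. -/
theorem IsLongest.card_extNbhd_rotEnds_lt {l₀ : List V} (h : G.IsLongest l₀) (hne : l₀ ≠ []) :
    (G.extNbhd (G.rotEnds l₀)).card < 2 * (G.rotEnds l₀).card := by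
  refine card_filter_not_isChain_lt h.1.1 (z := l₀.getLast hne)
    (List.getLast?_eq_some_getLast hne) ?_ _ ?_
  · rw [mem_rotEnds]
    refine ⟨l₀.dropLast, ?_⟩
    rw [List.dropLast_append_getLast]
    exact Rotates.refl
  · intro w hw
    rw [mem_extNbhd] at hw
    obtain ⟨hwR, u, huR, huw⟩ := hw
    rw [mem_rotEnds] at huR hwR
    obtain ⟨l, hl⟩ := huR
    have hlong := h.rotates hl
    have hmem : w ∈ l ++ [u] := by
      by_contra hc
      have := hlong.2 _ (hlong.1.concat huw hc)
      simp at this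
    have := not_isChain_of_adj_rotEnd hl huw hmem hwR
    simpa only [mem_rotEnds] using this

lemma exists_isLongest (G : SimpleGraph V) : ∃ l, G.IsLongest l := by
  have hfin : Set.Finite {k | ∃ l, G.IsPathList l ∧ l.length = k} := by
    refine (Set.finite_Iic (Fintype.card V)).subset ?_
    rintro k ⟨l, hl, rfl⟩
    exact hl.1.length_le_card
  obtain ⟨k, ⟨l, hl, rfl⟩, hk⟩ := Set.exists_max_image _ id hfin
    ⟨0, [], ⟨by simp, by simp⟩, rfl⟩
  exact ⟨l, hl, fun l' hl' => hk _ ⟨l', hl', rfl⟩⟩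

/-- The number of vertices of a longest path. -/
noncomputable def longestPath (G : SimpleGraph V) : ℕ := (Classical.choose G.exists_isLongest).length

lemma IsPathList.length_le {l : List V} (h : G.IsPathList l) : l.length ≤ G.longestPath :=
  (Classical.choose_spec G.exists_isLongest).2 l h

lemma isLongest_iff {l : List V} : G.IsLongest l ↔ G.IsPathList l ∧ l.length = G.longestPath := by
  constructor
  · intro h
    exact ⟨h.1, le_antisymm h.1.length_le (h.2 _ (Classical.choose_spec G.exists_isLongest).1)⟩
  · rintro ⟨h, h'⟩
    exact ⟨h, fun l' hl' => h' ▸ hl'.length_le⟩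

lemma longestPath_le_card (G : SimpleGraph V) : G.longestPath ≤ Fintype.card V :=
  (Classical.choose_spec G.exists_isLongest).1.1.length_le_card

lemma IsPathList.mono {G' : SimpleGraph V} (hle : G ≤ G') {l : List V} (h : G.IsPathList l) :
    G'.IsPathList l :=
  ⟨h.1, h.2.imp fun _ _ h => hle h⟩

lemma isHamiltonian_of_cycle_list {a b : V} {m : List V} (hm : m ≠ [])
    (h : G.IsPathList (a :: (m ++ [b]))) (hba : G.Adj b a) (hall : ∀ v, v ∈ a :: (m ++ [b])) :
    G.IsHamiltonian := by
  intro _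
  set p := Walk.ofSupport (a :: (m ++ [b])) (by simp) h.2 with hp
  have hlast : (a :: (m ++ [b])).getLast (by simp) = b := by simp
  have hhead : (a :: (m ++ [b])).head (by simp) = a := by simp
  set q : G.Walk a b := p.copy hhead hlast with hq
  have hqs : q.support = a :: (m ++ [b]) := by
    rw [hq, Walk.support_copy, hp, Walk.support_ofSupport]
  have hqp : q.IsPath := Walk.IsPath.mk' (by rw [hqs]; exact h.1)
  have hql : q.length = m.length + 1 := by
    have := Walk.length_support q
    rw [hqs] at this
    simp at this
    omega
  refine ⟨b, Walk.cons hba q, ?_⟩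
  rw [Walk.isHamiltonianCycle_isCycle_and_isHamiltonian_tail]
  constructor
  · rw [Walk.cons_isCycle_iff]
    -- A nonempty `m` excludes the degenerate closed walk that uses one edge twice.
    refine ⟨hqp, fun hc => ?_⟩
    rw [Sym2.eq_swap] at hc
    have := hqp.length_eq_one_of_mem_edges hc
    have := List.length_pos_of_ne_nil hm
    omega
  · have : q.IsHamiltonian := by
      rw [hqp.isHamiltonian_iff]
      intro w
      rw [hqs]
      exact hall w
    simpa [Walk.IsHamiltonian] using this

lemma Connected.exists_adj_of_list (hG : G.Connected) {l : List V} (hne : l ≠ []) {v : V}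
    (hv : v ∉ l) : ∃ y ∈ l, ∃ x, x ∉ l ∧ G.Adj y x := by
  obtain ⟨a, ha⟩ := List.exists_mem_of_ne_nil l hne
  obtain ⟨w⟩ := hG.preconnected a v
  obtain ⟨d, -, hd1, hd2⟩ := w.exists_boundary_dart {x | x ∈ l} ha hv
  exact ⟨d.fst, hd1, d.snd, hd2, d.adj⟩

/-- In a connected graph, a longest path whose ends are adjacent closes to a Hamiltonian cycle. -/
lemma Connected.isHamiltonian_of_isLongest (hG : G.Connected) {a b : V} {m : List V} (hm : m ≠ [])
    (h : G.IsLongest (a :: (m ++ [b]))) (hba : G.Adj b a) : G.IsHamiltonian := by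
  by_cases hall : ∀ v, v ∈ a :: (m ++ [b])
  · exact isHamiltonian_of_cycle_list hm h.1 hba hall
  exfalso
  push Not at hall
  obtain ⟨v, hv⟩ := hall
  obtain ⟨y, hy, x, hx, hyx⟩ := hG.exists_adj_of_list (by simp) hv
  obtain ⟨l₁, l₂, hl⟩ := List.append_of_mem hy
  -- The path closes to a cycle through `ba`. Cutting it just after `y` gives a path on the same
  -- vertices ending at `y`, which the outside neighbour `x` extends.
  have hperm : (l₂ ++ (l₁ ++ [y])).Perm (a :: (m ++ [b])) := by
    rw [hl]
    have : (l₂ ++ (l₁ ++ [y])).Perm ((l₁ ++ [y]) ++ l₂) := List.perm_append_comm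
    simpa using this
  have hchain : (l₂ ++ (l₁ ++ [y])).IsChain G.Adj := by
    have h0 := h.1.2
    rw [hl] at h0
    have e : l₁ ++ y :: l₂ = (l₁ ++ [y]) ++ l₂ := by simp
    rw [e] at h0
    refine h0.right_of_append.append h0.left_of_append ?_
    intro u hu w hw
    have hub : u = b := by
      have : (a :: (m ++ [b])).getLast? = some u := by
        rw [hl]
        rcases l₂ with _ | ⟨c, l₂⟩
        · simp at hu
        · rw [Option.mem_def] at hu
          simp [List.getLast?_append, List.getLast?_cons] at hu ⊢
          exact hu
      rw [show a :: (m ++ [b]) = (a :: m) ++ [b] by simp, List.getLast?_concat] at this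
      exact (Option.some.inj this).symm
    have hwa : w = a := by
      have : (a :: (m ++ [b])).head? = some w := by
        rw [hl, Option.mem_def.1 hw |>.symm]
        cases l₁ <;> simp
      exact (Option.some.inj this).symm
    rw [hub, hwa]
    exact hba
  have hp : G.IsPathList (l₂ ++ l₁ ++ [y]) := by
    rw [List.append_assoc]
    exact ⟨hperm.nodup_iff.2 h.1.1, hchain⟩
  have := h.2 _ (hp.concat hyx (by
    rw [List.append_assoc, hperm.mem_iff]
    exact hx))
  have h3 := hperm.length_eq
  simp only [List.length_append, List.length_cons, List.length_nil] at this h3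
  omega

/-! ### Expanders and boosters. -/

/-- A connected graph in which every set of at most a quarter of the vertices has an external
neighbourhood at least twice as large. -/
structure IsExpander (G : SimpleGraph V) : Prop where
  connected : G.Connected
  expand : ∀ S : Finset V, 4 * S.card ≤ Fintype.card V → 2 * S.card ≤ (G.extNbhd S).card

lemma IsExpander.mono {G' : SimpleGraph V} (hle : G ≤ G') (h : G.IsExpander) : G'.IsExpander where
  connected := h.connected.mono hle
  expand S hS := (h.expand S hS).trans (Finset.card_le_card fun w hw => by
    rw [mem_extNbhd] at hw ⊢
    obtain ⟨h1, v, hv, h2⟩ := hw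
    exact ⟨h1, v, hv, hle h2⟩)

/-- Adding the pair `e` creates a Hamiltonian cycle or a longer longest path. -/
def IsBooster (G : SimpleGraph V) (e : Sym2 V) : Prop :=
  (G ⊔ fromEdgeSet {e}).IsHamiltonian ∨ G.longestPath < (G ⊔ fromEdgeSet {e}).longestPath

open scoped Classical in
/-- The boosters of `G`. -/
noncomputable def boosters (G : SimpleGraph V) : Finset (Sym2 V) :=
  Finset.univ.filter fun e => e ∉ G.edgeSet ∧ ¬ e.IsDiag ∧ G.IsBooster e

lemma mem_boosters {e : Sym2 V} :
    e ∈ G.boosters ↔ e ∉ G.edgeSet ∧ ¬ e.IsDiag ∧ G.IsBooster e := by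
  simp [boosters]

/-- If the new edge does not lengthen the longest path, this path is still longest in the larger
graph, where its ends are adjacent; connectedness then closes it to a Hamiltonian cycle. -/
lemma mem_boosters_of_ends (hG : G.Connected) (hH : ¬ G.IsHamiltonian) {a b : V} {m : List V}
    (hm : m ≠ []) (h : G.IsLongest (a :: (m ++ [b]))) : s(a, b) ∈ G.boosters := by
  have hab : a ≠ b := by
    rintro rfl
    have := h.1.1
    simp at this
  rw [mem_boosters]
  refine ⟨fun hadj => hH (hG.isHamiltonian_of_isLongest hm h (G.adj_symm hadj)), by simpa using hab, ?_⟩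
  unfold IsBooster
  set G' := G ⊔ fromEdgeSet {s(a, b)}
  have hle : G ≤ G' := le_sup_left
  by_contra hc
  push Not at hc
  have hp := (isLongest_iff.1 h)
  have hp' : G'.IsPathList (a :: (m ++ [b])) := hp.1.mono hle
  refine hc.1 ((hG.mono hle).isHamiltonian_of_isLongest hm
    (isLongest_iff.2 ⟨hp', le_antisymm hp'.length_le (hp.2 ▸ hc.2)⟩) ?_)
  right
  rw [fromEdgeSet_adj]
  exact ⟨by simp [Sym2.eq_swap], hab.symm⟩

/-- Otherwise expansion would contradict Pósa's lemma for the set of ends. -/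
lemma IsExpander.lt_card_rotEnds (hG : G.IsExpander) {l : List V} (h : G.IsLongest l)
    (hne : l ≠ []) : Fintype.card V < 4 * (G.rotEnds l).card := by
  by_contra hc
  have := hG.expand _ (not_lt.1 hc)
  have := h.card_extNbhd_rotEnds_lt hne
  omega

lemma IsExpander.three_le_longestPath (hG : G.IsExpander) (hV : 4 ≤ Fintype.card V) :
    3 ≤ G.longestPath := by
  have := hG.connected.nonempty
  obtain ⟨v⟩ := this
  have h := hG.expand {v} (by simpa using hV)
  rw [Finset.card_singleton, mul_one] at h
  obtain ⟨x, hx, y, hy, hxy⟩ := Finset.one_lt_card.1 h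
  rw [mem_extNbhd] at hx hy
  simp only [Finset.mem_singleton, exists_eq_left] at hx hy
  obtain ⟨hx, hx'⟩ := hx
  obtain ⟨hy, hy'⟩ := hy
  have : G.IsPathList [x, v, y] :=
    ⟨by simp [hx, hxy, Ne.symm hy], by simp [hx'.symm, hy']⟩
  exact this.length_le

/-- A non-Hamiltonian expander has quadratically many boosters. -/
theorem IsExpander.card_boosters (hG : G.IsExpander) (hV : 4 ≤ Fintype.card V)
    (hH : ¬ G.IsHamiltonian) : Fintype.card V ^ 2 ≤ 32 * G.boosters.card := by
  obtain ⟨l₀, h₀⟩ := G.exists_isLongest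
  have key : ∀ {l : List V}, G.IsLongest l → ∃ a m b, m ≠ [] ∧ l = a :: (m ++ [b]) := by
    intro l hl
    have hlen : 3 ≤ l.length := (isLongest_iff.1 hl).2 ▸ hG.three_le_longestPath hV
    rcases l with _ | ⟨a, l⟩
    · simp at hlen
    have hlne : l ≠ [] := by rintro rfl; simp at hlen
    refine ⟨a, l.dropLast, l.getLast hlne, ?_, by rw [List.dropLast_append_getLast]⟩
    intro hc
    have := congrArg List.length hc
    simp at this hlen
    omega
  obtain ⟨x, m₀, y, -, rfl⟩ := key h₀
  -- for every endpoint, a longest path that starts there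
  have hstart : ∀ r ∈ G.rotEnds (x :: (m₀ ++ [y])), ∃ l, G.IsLongest l ∧ l.head? = some r := by
    intro r hr
    rw [mem_rotEnds] at hr
    obtain ⟨l, hl⟩ := hr
    -- Rotations fix the first vertex, so reversing makes `r` the fixed end and the other end free
    -- to vary.
    exact ⟨(l ++ [r]).reverse, (h₀.rotates hl).reverse, by simp⟩
  choose! P hP hhead using hstart
  set R := G.rotEnds (x :: (m₀ ++ [y])) with hR
  set D := R.sigma fun r => G.rotEnds (P r) with hD
  have hnil : ∀ r ∈ R, P r ≠ [] := by
    intro r hr hc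
    have := hhead r hr
    rw [hc] at this
    simp at this
  -- More than n/4 first ends, each with more than n/4 last ends; an unordered pair arises at most
  -- twice, hence n²/32 below.
  have hDcard : Fintype.card V ^ 2 ≤ 16 * D.card := by
    rw [hD, Finset.card_sigma]
    have h1 : R.card * (Fintype.card V) ≤ ∑ r ∈ R, 4 * (G.rotEnds (P r)).card := by
      rw [← smul_eq_mul, ← Finset.sum_const]
      exact Finset.sum_le_sum fun r hr => (hG.lt_card_rotEnds (hP r hr) (hnil r hr)).le
    rw [← Finset.mul_sum] at h1
    have h2 := (hG.lt_card_rotEnds h₀ (by simp)).le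
    rw [← hR] at h2
    nlinarith
  have hmaps : ∀ d ∈ D, s(d.1, d.2) ∈ G.boosters := by
    rintro ⟨r, z⟩ hd
    rw [hD, Finset.mem_sigma] at hd
    obtain ⟨hr, hz⟩ := hd
    simp only at hr hz
    rw [mem_rotEnds] at hz
    obtain ⟨l, hl⟩ := hz
    have hlong := (hP r hr).rotates hl
    obtain ⟨a, m, b, hm, he⟩ := key hlong
    have hb : z = b := by
      have := congrArg List.getLast? he
      rw [show a :: (m ++ [b]) = (a :: m) ++ [b] by simp, List.getLast?_concat,
        List.getLast?_concat] at this
      exact Option.some.inj this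
    have ha : r = a := by
      have h1 := hl.head?
      rw [hhead r hr, he] at h1
      simpa using h1.symm
    subst ha hb
    rw [he] at hlong
    exact mem_boosters_of_ends hG.connected hH hm hlong
  have hfib := Finset.card_le_mul_card_image_of_maps_to (s := D) (t := G.boosters)
    (f := fun d => s(d.1, d.2)) hmaps 2 (by
      intro e _
      induction e with | h u v =>
      have : (D.filter fun d => s(d.1, d.2) = s(u, v)) ⊆ {⟨u, v⟩, ⟨v, u⟩} := by
        rintro ⟨a, b⟩ hd
        rw [Finset.mem_filter] at hd
        rw [Finset.mem_insert, Finset.mem_singleton]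
        rcases Sym2.eq_iff.1 hd.2 with ⟨h1, h2⟩ | ⟨h1, h2⟩
        · left; simp_all
        · right; simp_all
      exact (Finset.card_le_card this).trans Finset.card_le_two)
  omega

/-- Adding boosters one at a time: if every sparse non-Hamiltonian expander in `G` has a booster
in `G`, then a sparse expander in `G` forces `G` to be Hamiltonian. -/
theorem isHamiltonian_of_boosters {Γ : SimpleGraph V} (hΓG : Γ ≤ G) (hΓ : Γ.IsExpander) {m : ℕ}
    (hm : Γ.edgeSet.ncard + (Fintype.card V - Γ.longestPath) ≤ m)
    (hB : ∀ Γ' : SimpleGraph V, Γ' ≤ G → Γ'.edgeSet.ncard ≤ m → Γ'.IsExpander →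
      ¬ Γ'.IsHamiltonian → ∃ e ∈ Γ'.boosters, e ∈ G.edgeSet) : G.IsHamiltonian := by
  -- Each booster costs one edge and, unless it finishes the cycle, lowers this deficit, so edges
  -- plus deficit stays within `m`.
  induction hk : Fintype.card V - Γ.longestPath using Nat.strong_induction_on generalizing Γ with
  | _ k ih =>
    by_cases hH : Γ.IsHamiltonian
    · exact hH.mono hΓG
    obtain ⟨e, he, heG⟩ := hB Γ hΓG (by omega) hΓ hH
    rw [mem_boosters] at he
    have hle : Γ ⊔ fromEdgeSet {e} ≤ G := by
      refine sup_le hΓG ?_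
      rw [← fromEdgeSet_edgeSet G]
      exact fromEdgeSet_mono (by simpa using heG)
    have hcard : (Γ ⊔ fromEdgeSet {e}).edgeSet.ncard ≤ Γ.edgeSet.ncard + 1 := by
      rw [edgeSet_sup]
      refine (Set.ncard_union_le _ _).trans (Nat.add_le_add_left ?_ _)
      refine (Set.ncard_le_ncard (t := {e}) ?_ (Set.finite_singleton e)).trans (by simp)
      rw [edgeSet_fromEdgeSet]
      exact Set.sdiff_subset
    rcases he.2.2 with h | h
    · exact h.mono hle
    · have h1 := longestPath_le_card (Γ ⊔ fromEdgeSet {e})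
      exact ih _ (by omega) hle (hΓ.mono le_sup_left) (by omega) rfl

end SimpleGraph

/-! ### Greedy hitting sets. -/

/-- A greedy cover: a family of subsets of `E`, each of size at least `M`, where `|E| ≤ N`, is hit
up to a proportion `(1 - M / N) ^ q` by some set of `q` elements. -/
lemma exists_hitting_set {ι α : Type*} [DecidableEq α] (I : Finset ι) (f : ι → Finset α)
    (E : Finset α) {M N : ℝ} (hM : 0 < M) (hN : (E.card : ℝ) ≤ N) (hMN : M ≤ N)
    (hf : ∀ i ∈ I, f i ⊆ E) (hfM : ∀ i ∈ I, M ≤ (f i).card) (q : ℕ) :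
    ∃ T ⊆ E, T.card ≤ q ∧
      ((I.filter fun i => Disjoint (f i) T).card : ℝ) ≤ I.card * (1 - M / N) ^ q := by
  have hNpos : 0 < N := hM.trans_le hMN
  have h01 : 0 ≤ 1 - M / N := by
    rw [sub_nonneg, div_le_one hNpos]
    exact hMN
  induction q with
  | zero => exact ⟨∅, by simp, by simp, by simp⟩
  | succ q ih =>
    obtain ⟨T, hTE, hTq, hT⟩ := ih
    set U := I.filter fun i => Disjoint (f i) T with hU
    rcases U.eq_empty_or_nonempty with hUe | hUne
    · refine ⟨T, hTE, by omega, ?_⟩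
      rw [← hU, hUe]
      simp only [Finset.card_empty, Nat.cast_zero]
      positivity
    obtain ⟨i₀, hi₀⟩ := hUne
    have hi₀I := (Finset.mem_filter.1 hi₀).1
    have hEne : E.Nonempty := by
      have h1 := hfM i₀ hi₀I
      have h2 : 0 < (f i₀).card := by exact_mod_cast hM.trans_le h1
      exact (Finset.card_pos.1 h2).mono (hf i₀ hi₀I)
    have hsum : ∑ e ∈ E, ((U.filter fun i => e ∈ f i).card : ℝ) = ∑ i ∈ U, ((f i).card : ℝ) := by
      simp_rw [Finset.card_filter, Nat.cast_sum]
      rw [Finset.sum_comm]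
      refine Finset.sum_congr rfl fun i hi => ?_
      have : E.filter (fun e => e ∈ f i) = f i := by
        rw [Finset.filter_mem_eq_inter, Finset.inter_eq_right]
        exact hf i (Finset.mem_filter.1 hi).1
      conv_rhs => rw [← this]
      rw [Finset.card_filter, Nat.cast_sum]
    -- Averaging: some element of `E` lies in a proportion at least M / N of the sets not yet hit.
    have hex : ∃ e ∈ E, M * U.card / N ≤ ((U.filter fun i => e ∈ f i).card : ℝ) := by
      refine Finset.exists_le_of_sum_le hEne ?_
      rw [hsum, Finset.sum_const, nsmul_eq_mul]
      calc (E.card : ℝ) * (M * U.card / N) ≤ N * (M * U.card / N) := by gcongr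
        _ = U.card * M := by field_simp
        _ = ∑ _i ∈ U, M := by simp
        _ ≤ _ := Finset.sum_le_sum fun i hi => hfM i (Finset.mem_filter.1 hi).1
    obtain ⟨e, heE, he⟩ := hex
    refine ⟨insert e T, Finset.insert_subset heE hTE,
      (Finset.card_insert_le _ _).trans (by omega), ?_⟩
    have hsplit : (I.filter fun i => Disjoint (f i) (insert e T)) = U.filter fun i => ¬ e ∈ f i := by
      ext i
      simp only [hU, Finset.mem_filter, Finset.disjoint_insert_right]
      tauto
    have hcard := Finset.card_filter_add_card_filter_not (s := U) (fun i => e ∈ f i)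
    rw [hsplit]
    have hcard' : ((U.filter fun i => e ∈ f i).card : ℝ) + (U.filter fun i => ¬ e ∈ f i).card
        = U.card := by exact_mod_cast hcard
    have : ((U.filter fun i => ¬ e ∈ f i).card : ℝ) ≤ U.card * (1 - M / N) := by
      have : M * U.card / N = U.card * (M / N) := by ring
      rw [this] at he
      linarith
    calc ((U.filter fun i => ¬ e ∈ f i).card : ℝ) ≤ U.card * (1 - M / N) := this
      _ ≤ I.card * (1 - M / N) ^ q * (1 - M / N) := by gcongr
      _ = _ := by ring

/-! ### Sparse subgraphs and expansion. -/

namespace SimpleGraph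

variable {V : Type*} [Fintype V] [DecidableEq V] {G H Γ : SimpleGraph V}

open scoped Classical in
/-- The edges of `G` among the pairs in `B`. -/
noncomputable def edgesIn (G : SimpleGraph V) (B : Finset (Sym2 V)) : Finset (Sym2 V) :=
  B.filter (· ∈ G.edgeSet)

open scoped Classical in
/-- The neighbours of `v`. -/
noncomputable def nbrs (G : SimpleGraph V) (v : V) : Finset V :=
  Finset.univ.filter (G.Adj v)

/-- The pairs inside `X`. -/
def innerPairs (X : Finset V) : Finset (Sym2 V) := X.sym2.filter (¬ ·.IsDiag)

/-- The pairs between `A` and `B`. -/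
def crossPairs (A B : Finset V) : Finset (Sym2 V) := (A ×ˢ B).image fun x => s(x.1, x.2)

lemma mem_edgesIn {B : Finset (Sym2 V)} {e : Sym2 V} :
    e ∈ G.edgesIn B ↔ e ∈ B ∧ e ∈ G.edgeSet := by simp [edgesIn]

lemma mem_nbrs {v w : V} : w ∈ G.nbrs v ↔ G.Adj v w := by simp [nbrs]

lemma mk_mem_innerPairs {X : Finset V} {u v : V} :
    s(u, v) ∈ innerPairs X ↔ (u ∈ X ∧ v ∈ X) ∧ u ≠ v := by
  simp [innerPairs]

lemma mem_crossPairs {A B : Finset V} {e : Sym2 V} :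
    e ∈ crossPairs A B ↔ ∃ a ∈ A, ∃ b ∈ B, s(a, b) = e := by
  simp [crossPairs, and_assoc]

lemma ncard_edgeSet_eq (G : SimpleGraph V) : G.edgeSet.ncard = (G.edgesIn Finset.univ).card := by
  rw [← Set.ncard_coe_finset]
  congr 1
  ext e
  simp [mem_edgesIn]

lemma minDeg_le_card_nbrs (G : SimpleGraph V) (v : V) : G.minDeg ≤ (G.nbrs v).card := by
  classical
  unfold minDeg
  refine (G.minDegree_le_degree v).trans (le_of_eq ?_)
  rw [← card_neighborFinset_eq_degree]
  congr 1
  ext w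
  simp [mem_nbrs]

/-- Ordered pairs of adjacent vertices are at most twice as many as the pairs. -/
lemma card_le_two_mul_of_mk_mem (D : Finset (V × V)) (F : Finset (Sym2 V))
    (h : ∀ d ∈ D, s(d.1, d.2) ∈ F) : D.card ≤ 2 * F.card := by
  refine Finset.card_le_mul_card_image_of_maps_to (f := fun d : V × V => s(d.1, d.2)) h 2 ?_
  intro e _
  induction e with | h u v =>
  have : (D.filter fun d => s(d.1, d.2) = s(u, v)) ⊆ {(u, v), (v, u)} := by
    rintro ⟨a, b⟩ hd
    rw [Finset.mem_filter] at hd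
    rw [Finset.mem_insert, Finset.mem_singleton]
    rcases Sym2.eq_iff.1 hd.2 with ⟨h1, h2⟩ | ⟨h1, h2⟩
    · left; simp_all
    · right; simp_all
  exact (Finset.card_le_card this).trans Finset.card_le_two

lemma sum_card_nbrs_le (H : SimpleGraph V) (A : Finset V) :
    ∑ v ∈ A, (H.nbrs v).card ≤ 2 * H.edgeSet.ncard := by
  have := card_le_two_mul_of_mk_mem ((A.sigma fun v => H.nbrs v).image fun x => (x.1, x.2))
    (H.edgesIn Finset.univ) (by
      intro d hd
      rw [Finset.mem_image] at hd
      obtain ⟨⟨v, w⟩, hx, rfl⟩ := hd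
      rw [Finset.mem_sigma] at hx
      rw [mem_edgesIn]
      exact ⟨Finset.mem_univ _, mem_nbrs.1 hx.2⟩)
  rw [Finset.card_image_of_injective, Finset.card_sigma] at this
  · rw [ncard_edgeSet_eq]; exact this
  · rintro ⟨a, b⟩ ⟨c, d⟩ h
    simp only [Prod.mk.injEq] at h
    obtain ⟨rfl, rfl⟩ := h
    rfl

/-- Vertices of `Z` with a neighbour outside `Z` are at most as many as the edges. -/
lemma card_le_ncard_edgeSet (H : SimpleGraph V) (Z : Finset V)
    (h : ∀ w ∈ Z, ∃ x, x ∉ Z ∧ H.Adj x w) : Z.card ≤ H.edgeSet.ncard := by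
  choose! x hx hadj using h
  rw [ncard_edgeSet_eq]
  refine Finset.card_le_card_of_injOn (fun w => s(x w, w)) ?_ ?_
  · intro w hw
    rw [Finset.mem_coe, mem_edgesIn]
    exact ⟨Finset.mem_univ _, hadj w hw⟩
  · intro w hw w' hw' he
    rcases Sym2.eq_iff.1 he with ⟨-, h2⟩ | ⟨-, h2⟩
    · exact h2
    · exact absurd (h2 ▸ hw) (hx w' hw')

lemma card_nbrs_le_sdiff (v : V) :
    (G.nbrs v).card ≤ ((G \ H).nbrs v).card + (H.nbrs v).card := by
  refine (Finset.card_le_card ?_).trans (Finset.card_union_le _ _)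
  intro w hw
  rw [Finset.mem_union, mem_nbrs, mem_nbrs, sdiff_adj]
  rw [mem_nbrs] at hw
  tauto

lemma card_nbrs_le_ncard (H : SimpleGraph V) (v : V) : (H.nbrs v).card ≤ H.edgeSet.ncard :=
  H.card_le_ncard_edgeSet _ fun w hw =>
    ⟨v, by rw [mem_nbrs]; exact H.irrefl, mem_nbrs.1 hw⟩

/-- In a locally sparse graph, vertices with many neighbours outside `W` expand outside `W`. -/
lemma mul_card_le_extNbhd_sdiff {K b k : ℕ} (hk : 0 < k)
    (hsparse : ∀ X : Finset V, X.card ≤ (K + 1) * b →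
      2 * (K + 1) * (G.edgesIn (innerPairs X)).card ≤ k * X.card)
    (hΓ : Γ ≤ G) (A W : Finset V) (hA : A.card ≤ b) (hAk : ∀ v ∈ A, k ≤ (Γ.nbrs v \ W).card) :
    K * A.card ≤ (Γ.extNbhd A \ W).card := by
  by_contra hc
  push Not at hc
  -- If expansion fails, `X` has fewer than (K + 1)|A| vertices but spans at least k|A|/2 edges of
  -- `G`, too many for `hsparse`.
  set X := A ∪ (Γ.extNbhd A \ W) with hX
  have hXc : X.card ≤ A.card + (Γ.extNbhd A \ W).card := Finset.card_union_le _ _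
  have hXb : X.card ≤ (K + 1) * b := by nlinarith
  have h1 := hsparse X hXb
  have h2 : ∑ v ∈ A, (Γ.nbrs v \ W).card ≤ 2 * (G.edgesIn (innerPairs X)).card := by
    have := card_le_two_mul_of_mk_mem
      ((A.sigma fun v => Γ.nbrs v \ W).image fun x => (x.1, x.2)) (G.edgesIn (innerPairs X)) (by
        intro d hd
        rw [Finset.mem_image] at hd
        obtain ⟨⟨v, w⟩, hx, rfl⟩ := hd
        rw [Finset.mem_sigma, Finset.mem_sdiff, mem_nbrs] at hx
        obtain ⟨hv, hvw, hwW⟩ := hx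
        simp only at hv hvw hwW
        rw [mem_edgesIn, mk_mem_innerPairs]
        refine ⟨⟨⟨Finset.mem_union_left _ hv, ?_⟩, hvw.ne⟩, hΓ hvw⟩
        by_cases hwA : w ∈ A
        · exact Finset.mem_union_left _ hwA
        · refine Finset.mem_union_right _ (Finset.mem_sdiff.2 ⟨?_, hwW⟩)
          exact mem_extNbhd.2 ⟨hwA, v, hv, hvw⟩)
    rw [Finset.card_image_of_injective, Finset.card_sigma] at this
    · exact this
    · rintro ⟨a, b⟩ ⟨c, d⟩ h
      simp only [Prod.mk.injEq] at h
      obtain ⟨rfl, rfl⟩ := h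
      rfl
  have h3 : A.card * k ≤ ∑ v ∈ A, (Γ.nbrs v \ W).card := by
    rw [← smul_eq_mul, ← Finset.sum_const]
    exact Finset.sum_le_sum hAk
  have h4 : k * X.card < k * ((K + 1) * A.card) :=
    Nat.mul_lt_mul_of_pos_left (by nlinarith) hk
  have h5 : (K + 1) * (A.card * k) ≤ (K + 1) * (2 * (G.edgesIn (innerPairs X)).card) :=
    Nat.mul_le_mul_left _ (h3.trans h2)
  nlinarith

/-- A graph in which any two large sets are joined by many edges has a sparse spanning subgraph
that keeps `k` edges at each vertex (all of them if there are at most `k`) and in which any two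
large sets are still joined. -/
lemma exists_sparse_subgraph (G : SimpleGraph V) [Nonempty V] (k b L : ℕ) {M N : ℝ} (hM : 0 < M)
    (hMN : M ≤ N) (hN : (G.edgeSet.ncard : ℝ) ≤ N) (hL : 2 * N ≤ L * M)
    (hjoin : ∀ A B : Finset V, Disjoint A B → b ≤ A.card → b ≤ B.card →
      M ≤ (G.edgesIn (crossPairs A B)).card) :
    ∃ Γ ≤ G, Γ.edgeSet.ncard ≤ Fintype.card V * (k + L) ∧
      (∀ v, min k (G.nbrs v).card ≤ (Γ.nbrs v).card) ∧
      (∀ v, (G.nbrs v).card ≤ k → ∀ w, G.Adj v w → Γ.Adj v w) ∧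
      ∀ A B : Finset V, Disjoint A B → b ≤ A.card → b ≤ B.card → ∃ u ∈ A, ∃ v ∈ B, Γ.Adj u v := by
  classical
  set n := Fintype.card V with hn
  have hn0 : 0 < n := Fintype.card_pos
  set I : Finset (Finset V × Finset V) :=
    Finset.univ.filter fun x => Disjoint x.1 x.2 ∧ b ≤ x.1.card ∧ b ≤ x.2.card with hI
  obtain ⟨T, hTE, hTc, hT⟩ := exists_hitting_set I (fun x => G.edgesIn (crossPairs x.1 x.2))
    (G.edgesIn Finset.univ) hM (by rw [← ncard_edgeSet_eq]; exact hN) hMN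
    (fun x _ e he => by rw [mem_edgesIn] at he ⊢; exact ⟨Finset.mem_univ _, he.2⟩)
    (fun x hx => by
      rw [hI, Finset.mem_filter] at hx
      exact hjoin _ _ hx.2.1 hx.2.2.1 hx.2.2.2) (L * n)
  have hIc : (I.card : ℝ) ≤ 4 ^ n := by
    have : I.card ≤ 4 ^ n := by
      refine (Finset.card_le_univ _).trans ?_
      rw [Fintype.card_prod, Fintype.card_finset, ← hn, ← mul_pow]
      norm_num
    exact_mod_cast this
  -- There are at most 4^n pairs of sets, and L n greedy choices miss a proportion at most e^(-2n)
  -- of them. As 4 e^(-2) < 1, fewer than one pair is missed.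
  have hzero : (I.filter fun x => Disjoint (G.edgesIn (crossPairs x.1 x.2)) T).card = 0 := by
    have hNpos := hM.trans_le hMN
    have h1 : (1 - M / N) ^ (L * n) ≤ Real.exp (-2) ^ n := by
      rw [pow_mul]
      have h0 : 0 ≤ 1 - M / N := by rw [sub_nonneg, div_le_one hNpos]; exact hMN
      refine pow_le_pow_left₀ (by positivity) ?_ n
      calc (1 - M / N) ^ L ≤ Real.exp (-(M / N)) ^ L :=
            pow_le_pow_left₀ h0 (Real.one_sub_le_exp_neg _) _
        _ = Real.exp (-(L * (M / N))) := by rw [← Real.exp_nat_mul]; ring_nf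
        _ ≤ Real.exp (-2) := by
            rw [Real.exp_le_exp, neg_le_neg_iff, ← mul_div_assoc, le_div_iff₀ hNpos]
            exact hL
    have h2 : (4 : ℝ) * Real.exp (-2) < 1 := by
      have : (4 : ℝ) < Real.exp 2 := by
        have h := Real.exp_one_gt_d9
        have : Real.exp 2 = Real.exp 1 * Real.exp 1 := by rw [← Real.exp_add]; norm_num
        nlinarith
      rw [Real.exp_neg, ← div_eq_mul_inv, div_lt_one (Real.exp_pos _)]
      exact this
    have h3 : ((I.filter fun x => Disjoint (G.edgesIn (crossPairs x.1 x.2)) T).card : ℝ) < 1 :=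
      calc _ ≤ (I.card : ℝ) * (1 - M / N) ^ (L * n) := hT
        _ ≤ 4 ^ n * Real.exp (-2) ^ n := mul_le_mul hIc h1 (by
            have h0 : 0 ≤ 1 - M / N := by rw [sub_nonneg, div_le_one hNpos]; exact hMN
            positivity) (by positivity)
        _ = (4 * Real.exp (-2)) ^ n := by rw [mul_pow]
        _ < 1 := pow_lt_one₀ (by positivity) h2 hn0.ne'
    have : (I.filter fun x => Disjoint (G.edgesIn (crossPairs x.1 x.2)) T).card < 1 := by
      exact_mod_cast h3
    omega
  have hsub : ∀ v, ∃ P ⊆ G.nbrs v, P.card = min k (G.nbrs v).card := fun v =>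
    Finset.exists_subset_card_eq (min_le_right _ _)
  choose P hP hPc using hsub
  set F : Finset (Sym2 V) := (Finset.univ.sigma fun v => P v).image (fun x => s(x.1, x.2)) ∪ T
    with hF
  have hFG : ∀ e ∈ F, e ∈ G.edgeSet := by
    intro e he
    rw [hF, Finset.mem_union] at he
    rcases he with he | he
    · rw [Finset.mem_image] at he
      obtain ⟨⟨v, w⟩, hx, rfl⟩ := he
      rw [Finset.mem_sigma] at hx
      exact mem_nbrs.1 (hP v hx.2)
    · exact (mem_edgesIn.1 (hTE he)).2
  have hadj : ∀ {u v}, s(u, v) ∈ F → (fromEdgeSet (F : Set (Sym2 V))).Adj u v := by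
    intro u v h
    rw [fromEdgeSet_adj]
    exact ⟨h, G.ne_of_adj (hFG _ h)⟩
  have hPadj : ∀ v, ∀ w ∈ P v, (fromEdgeSet (F : Set (Sym2 V))).Adj v w := fun v w hw =>
    hadj (Finset.mem_union_left _ (Finset.mem_image.2 ⟨⟨v, w⟩, by simpa using hw, rfl⟩))
  refine ⟨fromEdgeSet (F : Set (Sym2 V)), ?_, ?_, ?_, ?_, ?_⟩
  · intro u v huv
    rw [fromEdgeSet_adj] at huv
    exact hFG _ huv.1
  · have h1 : (fromEdgeSet (F : Set (Sym2 V))).edgeSet.ncard ≤ F.card := by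
      rw [← Set.ncard_coe_finset]
      refine Set.ncard_le_ncard ?_ F.finite_toSet
      rw [edgeSet_fromEdgeSet]
      exact Set.sdiff_subset
    have h2 : F.card ≤ n * k + L * n := by
      refine (Finset.card_union_le _ _).trans (Nat.add_le_add (Finset.card_image_le.trans ?_) hTc)
      rw [Finset.card_sigma, hn, ← Finset.card_univ, ← smul_eq_mul, ← Finset.sum_const]
      exact Finset.sum_le_sum fun v _ => (hPc v).le.trans (min_le_left _ _)
    calc _ ≤ n * k + L * n := h1.trans h2
      _ = n * (k + L) := by ring
  · intro v
    rw [← hPc v]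
    exact Finset.card_le_card fun w hw => mem_nbrs.2 (hPadj v w hw)
  · intro v hv w hvw
    have : P v = G.nbrs v := Finset.eq_of_subset_of_card_le (hP v) (by rw [hPc v, min_eq_right hv])
    exact hPadj v w (this ▸ mem_nbrs.2 hvw)
  · intro A B hAB hA hB
    have hmem : (A, B) ∈ I := by simp [hI, hAB, hA, hB]
    have : ¬ Disjoint (G.edgesIn (crossPairs A B)) T := by
      intro hc
      have : (A, B) ∈ I.filter fun x => Disjoint (G.edgesIn (crossPairs x.1 x.2)) T :=
        Finset.mem_filter.2 ⟨hmem, hc⟩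
      rw [Finset.card_eq_zero.1 hzero] at this
      simp at this
    rw [Finset.not_disjoint_iff] at this
    obtain ⟨e, he, heT⟩ := this
    obtain ⟨a, ha, b', hb', rfl⟩ := mem_crossPairs.1 (mem_edgesIn.1 he).1
    exact ⟨a, ha, b', hb', hadj (Finset.mem_union_right _ heT)⟩

/-- Expansion of small and large sets gives an expander. -/
lemma isExpander_of_small_of_large [Nonempty V] {b : ℕ} (hb : 4 * b ≤ Fintype.card V)
    (hsmall : ∀ S : Finset V, S.card ≤ b → 2 * S.card ≤ (Γ.extNbhd S).card)
    (hlarge : ∀ A B : Finset V, Disjoint A B → b ≤ A.card → b ≤ B.card →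
      ∃ u ∈ A, ∃ v ∈ B, Γ.Adj u v) : Γ.IsExpander := by
  classical
  have hexp : ∀ S : Finset V, 4 * S.card ≤ Fintype.card V →
      2 * S.card ≤ (Γ.extNbhd S).card := by
    intro S hS
    by_cases hSb : S.card ≤ b
    · exact hsmall S hSb
    by_contra hc
    -- With fewer than 2|S| neighbours, at least n - 3|S| ≥ n/4 ≥ b vertices lie outside, and none
    -- of them is joined to `S`.
    set R := (S ∪ Γ.extNbhd S)ᶜ with hR
    have hRc : b ≤ R.card := by
      rw [hR, Finset.card_compl]
      have := Finset.card_union_le S (Γ.extNbhd S)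
      omega
    have hdis : Disjoint S R := by
      rw [Finset.disjoint_left]
      intro x hx hxR
      rw [hR, Finset.mem_compl, Finset.mem_union] at hxR
      exact hxR (Or.inl hx)
    obtain ⟨u, hu, v, hv, huv⟩ := hlarge S R hdis (by omega) hRc
    rw [hR, Finset.mem_compl, Finset.mem_union, not_or] at hv
    exact hv.2 (mem_extNbhd.2 ⟨hv.1, u, hu, huv⟩)
  refine ⟨⟨fun u v => ?_⟩, hexp⟩
  by_contra hc
  set S : Finset V := Finset.univ.filter fun w => Γ.Reachable u w with hS
  have hno : ∀ x ∈ S, ∀ y ∉ S, ¬ Γ.Adj x y := by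
    intro x hx y hy hxy
    simp only [hS, Finset.mem_filter, Finset.mem_univ, true_and] at hx hy
    exact hy (hx.trans hxy.reachable)
  have h1 : Γ.extNbhd S = ∅ := by
    refine Finset.eq_empty_of_forall_notMem fun w hw => ?_
    obtain ⟨hw, x, hx, hxw⟩ := mem_extNbhd.1 hw
    exact hno x hx w hw hxw
  have h2 : Γ.extNbhd Sᶜ = ∅ := by
    refine Finset.eq_empty_of_forall_notMem fun w hw => ?_
    obtain ⟨hw, x, hx, hxw⟩ := mem_extNbhd.1 hw
    rw [Finset.mem_compl, not_not] at hw
    exact hno w hw x (Finset.mem_compl.1 hx) hxw.symm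
  have hu : 0 < S.card := Finset.card_pos.2 ⟨u, by simp [hS]⟩
  have hv : 0 < Sᶜ.card := Finset.card_pos.2 ⟨v, by simpa [hS] using hc⟩
  -- A component and its complement have no external neighbours, so expansion forbids either to be
  -- small; but two large sets are joined.
  have h3 : b ≤ S.card := by
    by_contra hlt
    have := hexp S (by omega)
    rw [h1, Finset.card_empty] at this
    omega
  have h4 : b ≤ Sᶜ.card := by
    by_contra hlt
    have := hexp Sᶜ (by omega)
    rw [h2, Finset.card_empty] at this
    omega
  obtain ⟨x, hx, y, hy, hxy⟩ := hlarge S Sᶜ disjoint_compl_right h3 h4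
  exact hno x hx y (Finset.mem_compl.1 hy) hxy

end SimpleGraph

/-! ### Hamiltonicity after deleting few edges: the deterministic argument. -/

namespace SimpleGraph

variable {V : Type*} [Fintype V] [DecidableEq V] {G H Γ : SimpleGraph V}

/-- The properties of a random graph that make it resiliently Hamiltonian. -/
structure IsResilientlyHamiltonian (G : SimpleGraph V) (k C b c m : ℕ) (M N : ℝ) : Prop where
  minDeg_le : 2 * G.minDeg ≤ C * k
  sparse : ∀ X : Finset V, X.card ≤ (3 * C + 3) * b →
    2 * (3 * C + 3) * (G.edgesIn (innerPairs X)).card ≤ k * X.card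
  card_edges : (G.edgeSet.ncard : ℝ) ≤ N
  join : ∀ A B : Finset V, Disjoint A B → b ≤ A.card → b ≤ B.card →
    M + G.minDeg ≤ (G.edgesIn (crossPairs A B)).card
  codeg : ∀ u v, u ≠ v → (G.nbrs u ∩ G.nbrs v).card ≤ c
  small_far : ∀ u v, u ≠ v → (G.nbrs u).card < 4 * k → (G.nbrs v).card < 4 * k →
    ∀ w : G.Walk u v, 4 < w.length
  boosters : ∀ Γ ≤ G, Γ.edgeSet.ncard ≤ m → Fintype.card V ^ 2 ≤ 32 * Γ.boosters.card →
    G.minDeg ≤ (G.edgesIn Γ.boosters).card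

/-- The expansion of small sets when the low-degree vertices of `G` are far apart. -/
lemma two_mul_card_le_extNbhd_of_far {k K b c : ℕ} (hk : 0 < k) (hK : 3 ≤ K) (hck : c + 1 ≤ k)
    (hsparse : ∀ X : Finset V, X.card ≤ (K + 1) * b →
      2 * (K + 1) * (G.edgesIn (innerPairs X)).card ≤ k * X.card)
    (hΓG : Γ ≤ G) (hcodeg : ∀ u v, u ≠ v → (G.nbrs u ∩ G.nbrs v).card ≤ c)
    {P : V → Prop} (hfar : ∀ u v, u ≠ v → P u → P v → ∀ w : G.Walk u v, 4 < w.length)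
    (hdeg : ∀ v, 2 ≤ (Γ.nbrs v).card) (hdegP : ∀ v, ¬ P v → 2 * k ≤ (Γ.nbrs v).card)
    (S : Finset V) (hS : S.card ≤ b) : 2 * S.card ≤ (Γ.extNbhd S).card := by
  classical
  set T := S.filter P with hT
  set A := S.filter (¬ P ·) with hA
  have hTA : T.card + A.card = S.card := Finset.card_filter_add_card_filter_not _
  set W := T ∪ Γ.extNbhd T with hW
  have hTP : ∀ t ∈ T, P t := fun t ht => (Finset.mem_filter.1 ht).2
  have hWt : ∀ w ∈ W, ∃ t ∈ T, w = t ∨ G.Adj t w := by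
    intro w hw
    rw [hW, Finset.mem_union, mem_extNbhd] at hw
    rcases hw with hw | ⟨-, t, ht, htw⟩
    · exact ⟨w, hw, Or.inl rfl⟩
    · exact ⟨t, ht, Or.inr (hΓG htw)⟩
  have hwalk : ∀ v w t, G.Adj v w → (w = t ∨ G.Adj t w) → ∃ q : G.Walk v t, q.length ≤ 2 := by
    rintro v w t hvw (rfl | htw)
    · exact ⟨hvw.toWalk, by simp⟩
    · exact ⟨Walk.cons hvw htw.symm.toWalk, by simp⟩
  -- All neighbours of `v` in `W` come from one low vertex `t`, since two would be within distance
  -- 4. Each is `t` itself or a common neighbour of `v` and `t`, so there are at most c + 1.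
  have hAW : ∀ v ∈ A, k ≤ (Γ.nbrs v \ W).card := by
    intro v hv
    have hvP : ¬ P v := (Finset.mem_filter.1 hv).2
    have h1 : (Γ.nbrs v ∩ W).card ≤ c + 1 := by
      rcases (Γ.nbrs v ∩ W).eq_empty_or_nonempty with he | ⟨w₀, hw₀⟩
      · rw [he]; simp
      rw [Finset.mem_inter, mem_nbrs] at hw₀
      obtain ⟨t, ht, hwt⟩ := hWt w₀ hw₀.2
      have hvt : v ≠ t := by rintro rfl; exact hvP (hTP _ ht)
      have hsub : Γ.nbrs v ∩ W ⊆ insert t (G.nbrs v ∩ G.nbrs t) := by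
        intro w hw
        rw [Finset.mem_inter, mem_nbrs] at hw
        obtain ⟨t', ht', hwt'⟩ := hWt w hw.2
        obtain ⟨q, hq⟩ := hwalk v w₀ t (hΓG hw₀.1) hwt
        obtain ⟨q', hq'⟩ := hwalk v w t' (hΓG hw.1) hwt'
        have htt : t = t' := by
          by_contra hne
          have := hfar t t' hne (hTP t ht) (hTP t' ht') (q.reverse.append q')
          rw [Walk.length_append, Walk.length_reverse] at this
          omega
        subst htt
        rw [Finset.mem_insert, Finset.mem_inter, mem_nbrs, mem_nbrs]
        rcases hwt' with h | h
        · exact Or.inl h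
        · exact Or.inr ⟨hΓG hw.1, h⟩
      exact (Finset.card_le_card hsub).trans
        ((Finset.card_insert_le _ _).trans (Nat.add_le_add_right (hcodeg v t hvt) 1))
    have h2 := Finset.card_sdiff_add_card_inter (Γ.nbrs v) W
    have h3 := hdegP v hvP
    omega
  have hAb : A.card ≤ b := by omega
  have hexpA := mul_card_le_extNbhd_sdiff hk hsparse hΓG A W hAb hAW
  have hexpT : 2 * T.card ≤ (Γ.extNbhd T).card := by
    have hsub : T.biUnion Γ.nbrs ⊆ Γ.extNbhd T := by
      intro w hw
      rw [Finset.mem_biUnion] at hw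
      obtain ⟨t, ht, hw⟩ := hw
      rw [mem_nbrs] at hw
      refine mem_extNbhd.2 ⟨fun hwT => ?_, t, ht, hw⟩
      have := hfar t w hw.ne (hTP t ht) (hTP w hwT) (hΓG hw).toWalk
      simp at this
    refine le_trans ?_ (Finset.card_le_card hsub)
    rw [Finset.card_biUnion]
    · rw [mul_comm, ← smul_eq_mul, ← Finset.sum_const]
      exact Finset.sum_le_sum fun t _ => hdeg t
    · intro t ht t' ht' hne
      rw [Function.onFun, Finset.disjoint_left]
      intro w hw hw'
      rw [mem_nbrs] at hw hw'
      have := hfar t t' hne (hTP t ht) (hTP t' ht')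
        (Walk.cons (hΓG hw) (hΓG hw').symm.toWalk)
      simp at this
  have hsub : (Γ.extNbhd T \ A) ∪ (Γ.extNbhd A \ W) ⊆ Γ.extNbhd S := by
    intro w hw
    rw [Finset.mem_union, Finset.mem_sdiff, Finset.mem_sdiff, mem_extNbhd, mem_extNbhd] at hw
    have hST : ∀ x, x ∉ T → x ∉ A → x ∉ S := by
      intro x h1 h2 h3
      by_cases hx : P x
      · exact h1 (Finset.mem_filter.2 ⟨h3, hx⟩)
      · exact h2 (Finset.mem_filter.2 ⟨h3, hx⟩)
    rcases hw with ⟨⟨h1, v, hv, h2⟩, h3⟩ | ⟨⟨h1, v, hv, h2⟩, h3⟩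
    · exact mem_extNbhd.2 ⟨hST w h1 h3, v, (Finset.mem_filter.1 hv).1, h2⟩
    · refine mem_extNbhd.2 ⟨hST w (fun h => h3 ?_) h1, v, (Finset.mem_filter.1 hv).1, h2⟩
      exact Finset.mem_union_left _ h
  have hdis : Disjoint (Γ.extNbhd T \ A) (Γ.extNbhd A \ W) := by
    rw [Finset.disjoint_left]
    intro w hw hw'
    rw [Finset.mem_sdiff] at hw hw'
    exact hw'.2 (Finset.mem_union_right _ hw.1)
  -- `T` contributes at least 2|T| - |A| neighbours and `A` at least 3|A| more, in total 2|S|.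
  have h1 := Finset.card_le_card hsub
  rw [Finset.card_union_of_disjoint hdis] at h1
  have h2 := Finset.le_card_sdiff A (Γ.extNbhd T)
  have h3 : 3 * A.card ≤ K * A.card := Nat.mul_le_mul_right _ hK
  omega

/-- The expansion of small sets when there are few low-degree vertices, and any two vertices have
many neighbours altogether. -/
lemma two_mul_card_le_extNbhd_of_few {k C b c : ℕ} (hk : 0 < k)
    (hsparse : ∀ X : Finset V, X.card ≤ (3 * C + 3) * b →
      2 * (3 * C + 3) * (G.edgesIn (innerPairs X)).card ≤ k * X.card)
    (hΓG : Γ ≤ G) (hcodeg : ∀ u v, u ≠ v → (G.nbrs u ∩ G.nbrs v).card ≤ c)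
    (hH : H.edgeSet.ncard + 2 ≤ G.minDeg) (hδ : c + 3 * C ≤ G.minDeg)
    (hdeg : ∀ v, 2 ≤ (Γ.nbrs v).card) {P : V → Prop}
    (hP : ∀ T : Finset V, (∀ v ∈ T, P v) → T.card ≤ C)
    (hdegP : ∀ v, ¬ P v → k ≤ (Γ.nbrs v).card)
    (hkeep : ∀ v, P v → ∀ w, (G \ H).Adj v w → Γ.Adj v w)
    (S : Finset V) (hS : S.card ≤ b) : 2 * S.card ≤ (Γ.extNbhd S).card := by
  classical
  set T := S.filter P with hT
  set A := S.filter (¬ P ·) with hA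
  have hTA : T.card + A.card = S.card := Finset.card_filter_add_card_filter_not _
  have hTC : T.card ≤ C := hP T fun v hv => (Finset.mem_filter.1 hv).2
  rcases A.eq_empty_or_nonempty with hAe | hAne
  · have hST : S = T := by
      rw [hT, eq_comm, Finset.filter_true_of_mem]
      intro v hv
      by_contra hc
      have : v ∈ A := Finset.mem_filter.2 ⟨hv, hc⟩
      rw [hAe] at this
      simp at this
    have hSP : ∀ v ∈ S, P v := fun v hv => by rw [hST] at hv; exact (Finset.mem_filter.1 hv).2
    rcases Nat.lt_or_ge 1 S.card with h2 | h1
    · obtain ⟨u, hu, v, hv, huv⟩ := Finset.one_lt_card.1 h2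
      -- Two vertices of `S` have at least 2δ - c neighbours in `G`. At most C of them lie in `S`,
      -- and at most e(H) ≤ δ - 2 lie in `Z`; since δ ≥ c + 3C, at least 2|S| survive in Γ.
      set Z := Finset.univ.filter fun w => w ∉ S ∧ ∃ x ∈ S, H.Adj x w with hZ
      have hZc : Z.card ≤ H.edgeSet.ncard := by
        refine H.card_le_ncard_edgeSet Z fun w hw => ?_
        obtain ⟨-, hwS, x, hx, hxw⟩ := Finset.mem_filter.1 hw
        exact ⟨x, fun hxZ => (Finset.mem_filter.1 hxZ).2.1 hx, hxw⟩
      have hsub : G.nbrs u ∪ G.nbrs v ⊆ Γ.extNbhd S ∪ (S ∪ Z) := by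
        intro w hw
        have : ∃ x ∈ S, G.Adj x w := by
          rw [Finset.mem_union, mem_nbrs, mem_nbrs] at hw
          rcases hw with h | h
          · exact ⟨u, hu, h⟩
          · exact ⟨v, hv, h⟩
        obtain ⟨x, hx, hxw⟩ := this
        by_cases hwS : w ∈ S
        · exact Finset.mem_union_right _ (Finset.mem_union_left _ hwS)
        by_cases hH' : H.Adj x w
        · refine Finset.mem_union_right _ (Finset.mem_union_right _ ?_)
          exact Finset.mem_filter.2 ⟨Finset.mem_univ _, hwS, x, hx, hH'⟩
        · refine Finset.mem_union_left _ (mem_extNbhd.2 ⟨hwS, x, hx, ?_⟩)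
          exact hkeep x (hSP x hx) w ⟨hxw, hH'⟩
      have h3 := Finset.card_le_card hsub
      have h4 := Finset.card_union_le (Γ.extNbhd S) (S ∪ Z)
      have h5 := Finset.card_union_le S Z
      have h6 := Finset.card_union_add_card_inter (G.nbrs u) (G.nbrs v)
      have h7 := hcodeg u v huv
      have h8 := G.minDeg_le_card_nbrs u
      have h9 := G.minDeg_le_card_nbrs v
      have h10 : A.card = 0 := by rw [hAe, Finset.card_empty]
      omega
    · rcases S.eq_empty_or_nonempty with hSe | ⟨v, hv⟩
      · rw [hSe]; simp
      have hSv : S = {v} := by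
        refine Finset.eq_singleton_iff_unique_mem.2 ⟨hv, fun x hx => ?_⟩
        exact Finset.card_le_one.1 h1 x hx v hv
      rw [hSv, Finset.card_singleton, mul_one]
      refine (hdeg v).trans (Finset.card_le_card fun w hw => ?_)
      rw [mem_nbrs] at hw
      exact mem_extNbhd.2 ⟨by simpa using hw.ne', v, by simp, hw⟩
  · have h1 := mul_card_le_extNbhd_sdiff (K := 3 * C + 2) hk hsparse hΓG A ∅ (by omega)
      (fun v hv => by simpa using hdegP v (Finset.mem_filter.1 hv).2)
    rw [Finset.sdiff_empty] at h1
    have hsub : Γ.extNbhd A \ T ⊆ Γ.extNbhd S := by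
      intro w hw
      rw [Finset.mem_sdiff, mem_extNbhd] at hw
      obtain ⟨⟨h1, v, hv, h2⟩, h3⟩ := hw
      refine mem_extNbhd.2 ⟨fun h => ?_, v, (Finset.mem_filter.1 hv).1, h2⟩
      by_cases hx : P w
      · exact h3 (Finset.mem_filter.2 ⟨h, hx⟩)
      · exact h1 (Finset.mem_filter.2 ⟨h, hx⟩)
    have h2 := Finset.card_le_card hsub
    have h3 := Finset.le_card_sdiff T (Γ.extNbhd A)
    have h4 : 0 < A.card := Finset.card_pos.2 hAne
    have h5 : C * 1 ≤ C * A.card := Nat.mul_le_mul_left _ h4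
    have h6 : (3 * C + 2) * A.card = 3 * (C * A.card) + 2 * A.card := by ring
    omega

/-- Deleting fewer than `δ(G) - 1` edges keeps `G` Hamiltonian. -/
theorem IsResilientlyHamiltonian.isHamiltonian_sdiff [Nonempty V] {k C b c m L : ℕ} {M N : ℝ}
    (h : G.IsResilientlyHamiltonian k C b c m M N) (hk : 0 < k) (hC : 1 ≤ C)
    (hb : 4 * b ≤ Fintype.card V) (hV : 4 ≤ Fintype.card V) (hck : c + 3 * C ≤ k)
    (hM : 0 < M) (hMN : M ≤ N) (hL : 2 * N ≤ L * M)
    (hm : Fintype.card V * (2 * k + L + 1) ≤ m)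
    (hH : H.edgeSet.ncard + 2 ≤ G.minDeg) : (G \ H).IsHamiltonian := by
  classical
  have hle : G \ H ≤ G := sdiff_le
  obtain ⟨Γ, hΓ, hΓc, hΓdeg, hΓkeep, hΓjoin⟩ := (G \ H).exists_sparse_subgraph (2 * k) b L hM hMN
    (by
      refine le_trans ?_ h.card_edges
      exact_mod_cast Set.ncard_le_ncard (edgeSet_mono hle) (Set.toFinite _)) hL (by
      intro A B hAB hA hB
      have h1 := h.join A B hAB hA hB
      have h2 : (G.edgesIn (crossPairs A B)).card ≤
          ((G \ H).edgesIn (crossPairs A B)).card + H.edgeSet.ncard := by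
        rw [ncard_edgeSet_eq]
        refine (Finset.card_le_card ?_).trans (Finset.card_union_le _ _)
        intro e he
        rw [Finset.mem_union, mem_edgesIn, mem_edgesIn, edgeSet_sdiff]
        rw [mem_edgesIn] at he
        by_cases hc : e ∈ H.edgeSet
        · exact Or.inr ⟨Finset.mem_univ _, hc⟩
        · exact Or.inl ⟨he.1, he.2, hc⟩
      have h3 : ((G.edgesIn (crossPairs A B)).card : ℝ) ≤
          ((G \ H).edgesIn (crossPairs A B)).card + H.edgeSet.ncard := by exact_mod_cast h2
      have h4 : (H.edgeSet.ncard : ℝ) ≤ G.minDeg := by exact_mod_cast (by omega)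
      linarith)
  have hΓG : Γ ≤ G := hΓ.trans hle
  have hdegGH : ∀ v, (G.nbrs v).card ≤ ((G \ H).nbrs v).card + H.edgeSet.ncard := fun v =>
    card_nbrs_le_sdiff v |>.trans (Nat.add_le_add_left (H.card_nbrs_le_ncard v) _)
  have hdeg2 : ∀ v, 2 ≤ (Γ.nbrs v).card := by
    intro v
    have h1 := hdegGH v
    have h2 := G.minDeg_le_card_nbrs v
    exact le_trans (le_min (by omega) (by omega)) (hΓdeg v)
  have hsmall : ∀ S : Finset V, S.card ≤ b → 2 * S.card ≤ (Γ.extNbhd S).card := by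
    -- For δ > 2k, a vertex of degree below k in `G \ H` has lost at least k edges, and the degrees
    -- of `H` sum to less than 2δ ≤ Ck. For δ ≤ 2k, a vertex of degree at least 4k keeps at least
    -- 2k.
    rcases Nat.lt_or_ge (2 * k) G.minDeg with hδ | hδ
    · refine two_mul_card_le_extNbhd_of_few (P := fun v => ((G \ H).nbrs v).card < k) hk h.sparse
        hΓG h.codeg hH (by omega) hdeg2 ?_ ?_ ?_
      · intro T hT
        have h1 : T.card * k ≤ ∑ v ∈ T, (H.nbrs v).card := by
          rw [← smul_eq_mul, ← Finset.sum_const]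
          refine Finset.sum_le_sum fun v hv => ?_
          have h1 := card_nbrs_le_sdiff (G := G) (H := H) v
          have h2 := G.minDeg_le_card_nbrs v
          have h3 := hT v hv
          omega
        have h2 := h1.trans (H.sum_card_nbrs_le T)
        have h3 := h.minDeg_le
        have h4 : T.card * k ≤ C * k := by omega
        exact Nat.le_of_mul_le_mul_right h4 hk
      · intro v hv
        exact le_trans (le_min (by omega) (by omega)) (hΓdeg v)
      · intro v hv w hvw
        exact hΓkeep v (by omega) w hvw
    · refine two_mul_card_le_extNbhd_of_far (P := fun v => (G.nbrs v).card < 4 * k)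
        (K := 3 * C + 2) hk (by omega) (by omega) h.sparse hΓG h.codeg h.small_far hdeg2 ?_
      intro v hv
      have h1 := hdegGH v
      exact le_trans (le_min (by omega) (by omega)) (hΓdeg v)
  have hexp : Γ.IsExpander := isExpander_of_small_of_large hb hsmall hΓjoin
  refine isHamiltonian_of_boosters (m := m) hΓ hexp ?_ ?_
  · refine le_trans ?_ hm
    have : Fintype.card V * (2 * k + L + 1) = Fintype.card V * (2 * k + L) + Fintype.card V := by
      ring
    omega
  · intro Γ' hΓ' hΓ'm hΓ'e hΓ'H
    have h1 := h.boosters Γ' (hΓ'.trans hle) hΓ'm (hΓ'e.card_boosters hV hΓ'H)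
    -- At least δ boosters are edges of `G`, and `H` has at most δ - 2 edges.
    have h2 : ¬ G.edgesIn Γ'.boosters ⊆ H.edgesIn Finset.univ := by
      intro hc
      have := Finset.card_le_card hc
      rw [← ncard_edgeSet_eq] at this
      omega
    rw [Finset.not_subset] at h2
    obtain ⟨e, he, heH⟩ := h2
    rw [mem_edgesIn] at he
    refine ⟨e, he.1, ?_⟩
    rw [edgeSet_sdiff]
    exact ⟨he.2, fun hc => heH (mem_edgesIn.2 ⟨Finset.mem_univ _, hc⟩)⟩

end SimpleGraph

/-! ### The value of the resilience. -/

namespace SimpleGraph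

variable {V : Type*} [Fintype V] [DecidableEq V] {G : SimpleGraph V}

lemma exists_card_nbrs_eq_minDeg [Nonempty V] (G : SimpleGraph V) :
    ∃ v, (G.nbrs v).card = G.minDeg := by
  classical
  obtain ⟨v, hv⟩ := G.exists_minimal_degree_vertex
  refine ⟨v, ?_⟩
  unfold minDeg
  rw [hv, ← card_neighborFinset_eq_degree]
  congr 1
  ext w
  simp [mem_nbrs]

lemma IsHamiltonian.one_lt_card_nbrs (hG : G.IsHamiltonian) (hV : 3 ≤ Fintype.card V) (v : V) :
    1 < (G.nbrs v).card := by
  have : Nontrivial V := Fintype.one_lt_card_iff_nontrivial.1 (by omega)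
  obtain ⟨p, hp⟩ := hG.exists_isHamiltonianCycle v
  refine Finset.one_lt_card.2 ⟨p.snd, ?_, p.penultimate, ?_, hp.isCycle.snd_ne_penultimate⟩
  · rw [mem_nbrs]; exact p.adj_snd hp.isCycle.not_nil
  · rw [mem_nbrs]; exact (p.adj_penultimate hp.isCycle.not_nil).symm

/-- Removing δ - 1 edges at a vertex of degree δ leaves degree 1 there. This also shows that the set
defining the resilience is nonempty, so its infimum is not the default 0. δ ≥ 1 reconciles natural
and integer subtraction. -/
theorem globalResilience_isHamiltonian_eq (hV : 3 ≤ Fintype.card V) (hδ : 1 ≤ G.minDeg)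
    (h : ∀ H : SimpleGraph V, H ≤ G → H.edgeSet.ncard + 2 ≤ G.minDeg → (G \ H).IsHamiltonian) :
    (G.globalResilience IsHamiltonian : ℤ) = (G.minDeg : ℤ) - 1 := by
  classical
  have : Nonempty V := Fintype.card_pos_iff.1 (by omega)
  obtain ⟨v, hv⟩ := G.exists_card_nbrs_eq_minDeg
  obtain ⟨P, hP, hPc⟩ := Finset.exists_subset_card_eq (s := G.nbrs v) (n := G.minDeg - 1) (by omega)
  set F : Finset (Sym2 V) := P.image fun w => s(v, w) with hF
  have hFc : F.card = G.minDeg - 1 := by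
    rw [hF, Finset.card_image_of_injective, hPc]
    intro a b hab
    exact Sym2.congr_right.1 hab
  have hadj : ∀ w ∈ P, G.Adj v w := fun w hw => mem_nbrs.1 (hP hw)
  have hFG : (F : Set (Sym2 V)) ⊆ G.edgeSet := by
    intro e he
    rw [Finset.mem_coe, hF, Finset.mem_image] at he
    obtain ⟨w, hw, rfl⟩ := he
    exact hadj w hw
  set H := fromEdgeSet (F : Set (Sym2 V)) with hH
  have hHe : H.edgeSet = F := by
    rw [hH, edgeSet_fromEdgeSet, sdiff_eq_left, Set.disjoint_left]
    intro e he
    exact G.not_isDiag_of_mem_edgeSet (hFG he)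
  have hmem : G.minDeg - 1 ∈ {m : ℕ | ∃ H : SimpleGraph V, H ≤ G ∧ H.edgeSet.ncard = m ∧
      ¬ (G \ H).IsHamiltonian} := by
    refine ⟨H, ?_, ?_, ?_⟩
    · rw [← edgeSet_subset_edgeSet, hHe]; exact hFG
    · rw [hHe, Set.ncard_coe_finset, hFc]
    · intro hham
      have h1 := hham.one_lt_card_nbrs hV v
      have h2 : (G \ H).nbrs v ⊆ G.nbrs v \ P := by
        intro w hw
        rw [mem_nbrs, sdiff_adj] at hw
        rw [Finset.mem_sdiff, mem_nbrs]
        refine ⟨hw.1, fun hwP => hw.2 ?_⟩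
        rw [← mem_edgeSet, hHe, hF]
        exact Finset.mem_coe.2 (Finset.mem_image.2 ⟨w, hwP, rfl⟩)
      have h3 := Finset.card_le_card h2
      rw [Finset.card_sdiff_of_subset hP] at h3
      omega
  have heq : G.globalResilience IsHamiltonian = G.minDeg - 1 := by
    refine le_antisymm (Nat.sInf_le hmem) ?_
    refine le_csInf ⟨_, hmem⟩ ?_
    rintro m ⟨H', hH', rfl, hn⟩
    by_contra hc
    exact hn (h H' hH' (by omega))
  rw [heq]
  push_cast [hδ]
  ring

end SimpleGraph

/-! ### Exponential moment bounds in the binomial random graph. -/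

namespace SimpleGraph

open MeasureTheory

variable {V : Type*} [Fintype V] [DecidableEq V] {G : SimpleGraph V}

variable (V) in
/-- All pairs of distinct vertices. -/
def allPairs : Finset (Sym2 V) := Finset.univ.filter (¬ ·.IsDiag)

lemma mem_allPairs {e : Sym2 V} : e ∈ allPairs V ↔ ¬ e.IsDiag := by simp [allPairs]

lemma card_allPairs : (allPairs V).card = (Fintype.card V).choose 2 := by
  rw [allPairs, ← Sym2.card_subtype_not_diag, Fintype.card_subtype]

lemma edgesIn_subset {B : Finset (Sym2 V)} : G.edgesIn B ⊆ B := fun _ he => (mem_edgesIn.1 he).1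

lemma edgesIn_allPairs_eq_univ : G.edgesIn (allPairs V) = G.edgesIn Finset.univ := by
  ext e
  rw [mem_edgesIn, mem_edgesIn, mem_allPairs]
  have := G.not_isDiag_of_mem_edgeSet (e := e)
  simpa using this

/-- Sums over graphs are sums over sets of pairs. -/
lemma sum_graphs_le_sum_powerset {f : Finset (Sym2 V) → ℝ} (hf : ∀ S, 0 ≤ f S)
    (I : Finset (SimpleGraph V)) :
    ∑ G ∈ I, f (G.edgesIn (allPairs V)) ≤ ∑ S ∈ (allPairs V).powerset, f S := by
  have hinj : Function.Injective fun G : SimpleGraph V => G.edgesIn (allPairs V) := by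
    intro G G' h
    simp only [edgesIn_allPairs_eq_univ] at h
    refine edgeSet_injective (Set.ext fun e => ?_)
    have := Finset.ext_iff.1 h e
    simpa [mem_edgesIn] using this
  classical
  rw [← Finset.sum_image (f := f) (g := fun G : SimpleGraph V => G.edgesIn (allPairs V))
    (fun x _ y _ h => hinj h)]
  refine Finset.sum_le_sum_of_subset_of_nonneg ?_ fun S _ _ => hf S
  intro S hS
  rw [Finset.mem_image] at hS
  obtain ⟨G, -, rfl⟩ := hS
  exact Finset.mem_powerset.2 edgesIn_subset

lemma binomialRandom_real_singleton (p : unitInterval) (G : SimpleGraph V) :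
    (binomialRandom V p).real {G} = (p : ℝ) ^ (G.edgesIn (allPairs V)).card *
      (1 - p : ℝ) ^ ((allPairs V).card - (G.edgesIn (allPairs V)).card) := by
  rw [measureReal_def, binomialRandom_singleton, edgesIn_allPairs_eq_univ, ← ncard_edgeSet_eq,
    card_allPairs, Nat.card_eq_fintype_card]
  simp

/-- The exponential moment bound for the number of edges of a random graph in `B` on the event
that it contains `A`. -/
theorem binomialRandom_real_le (p : unitInterval) {A B : Finset (Sym2 V)} (hA : A ⊆ allPairs V)
    (hB : B ⊆ allPairs V) (hAB : Disjoint A B) {s t : ℝ} (hs : 0 ≤ s) (ht : 0 ≤ t)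
    (Q : Set (SimpleGraph V)) (hQA : ∀ G ∈ Q, (A : Set (Sym2 V)) ⊆ G.edgeSet)
    (hQB : ∀ G ∈ Q, 1 ≤ s * t ^ (G.edgesIn B).card) :
    (binomialRandom V p).real Q ≤ s * ((p : ℝ) ^ A.card * (1 + (t - 1) * p) ^ B.card) := by
  classical
  have hp0 : (0 : ℝ) ≤ p := p.2.1
  have hp1 : (0 : ℝ) ≤ 1 - p := sub_nonneg.2 p.2.2
  -- `f` weighs a pair as an edge, with a factor t on `B`; `g` weighs it as a non-edge and vanishes
  -- on `A`. The sum over all edge sets is then the product of f + g.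
  set f : Sym2 V → ℝ := fun e => p * (if e ∈ B then t else 1) with hf
  set g : Sym2 V → ℝ := fun e => (1 - p) * (if e ∈ A then 0 else 1) with hg
  set F : Finset (Sym2 V) → ℝ := fun S => s * ((∏ e ∈ S, f e) * ∏ e ∈ allPairs V \ S, g e) with hF
  have hf0 : ∀ e, 0 ≤ f e := fun e => mul_nonneg hp0 (by split_ifs <;> positivity)
  have hg0 : ∀ e, 0 ≤ g e := fun e => mul_nonneg hp1 (by split_ifs <;> norm_num)
  have hF0 : ∀ S, 0 ≤ F S := fun S =>
    mul_nonneg hs (mul_nonneg (Finset.prod_nonneg fun e _ => hf0 e)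
      (Finset.prod_nonneg fun e _ => hg0 e))
  have hprod : ∏ e ∈ allPairs V, (f e + g e) = (p : ℝ) ^ A.card * (1 + (t - 1) * p) ^ B.card := by
    have h1 : ∀ e ∈ allPairs V, f e + g e =
        (if e ∈ A then (p : ℝ) else 1) * (if e ∈ B then (1 + (t - 1) * p) else 1) := by
      intro e _
      simp only [hf, hg]
      by_cases hA' : e ∈ A
      · have : e ∉ B := Finset.disjoint_left.1 hAB hA'
        simp [hA', this]
      · by_cases hB' : e ∈ B
        · simp [hA', hB']; ring
        · simp [hA', hB']
    rw [Finset.prod_congr rfl h1, Finset.prod_mul_distrib, Finset.prod_ite_mem,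
      Finset.prod_ite_mem, Finset.inter_eq_right.2 hA, Finset.inter_eq_right.2 hB,
      Finset.prod_const, Finset.prod_const]
  have hterm : ∀ G ∈ Q, (binomialRandom V p).real {G} ≤ F (G.edgesIn (allPairs V)) := by
    intro G hG
    set S := G.edgesIn (allPairs V) with hS
    have hSsub : S ⊆ allPairs V := edgesIn_subset
    have h1 : ∏ e ∈ S, f e = (p : ℝ) ^ S.card * t ^ (G.edgesIn B).card := by
      have : S ∩ B = G.edgesIn B := by
        ext e
        rw [Finset.mem_inter, hS, mem_edgesIn, mem_edgesIn]
        have := @hB e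
        tauto
      simp only [hf]
      rw [Finset.prod_mul_distrib, Finset.prod_const, Finset.prod_ite_mem, this, Finset.prod_const]
    have h2 : ∏ e ∈ allPairs V \ S, g e = (1 - p : ℝ) ^ ((allPairs V).card - S.card) := by
      rw [← Finset.card_sdiff_of_subset hSsub, ← Finset.prod_const]
      refine Finset.prod_congr rfl fun e he => ?_
      rw [Finset.mem_sdiff, hS, mem_edgesIn, not_and] at he
      have : e ∉ A := fun h => he.2 he.1 (hQA G hG h)
      simp [hg, this]
    rw [binomialRandom_real_singleton]
    simp only [hF]
    rw [← hS, h1, h2]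
    have h3 := hQB G hG
    have h4 : 0 ≤ (p : ℝ) ^ S.card * (1 - p : ℝ) ^ ((allPairs V).card - S.card) := by positivity
    calc (p : ℝ) ^ S.card * (1 - p : ℝ) ^ ((allPairs V).card - S.card)
        ≤ (p : ℝ) ^ S.card * (1 - p : ℝ) ^ ((allPairs V).card - S.card) *
          (s * t ^ (G.edgesIn B).card) := le_mul_of_one_le_right h4 h3
      _ = _ := by ring
  set I : Finset (SimpleGraph V) := Finset.univ.filter (· ∈ Q) with hI
  have hQI : Q = ⋃ G ∈ I, {G} := by
    ext G
    simp [hI]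
  calc (binomialRandom V p).real Q ≤ ∑ G ∈ I, (binomialRandom V p).real {G} := by
        conv_lhs => rw [hQI]
        exact measureReal_biUnion_finset_le _ _
    _ ≤ ∑ G ∈ I, F (G.edgesIn (allPairs V)) :=
        Finset.sum_le_sum fun G hG => hterm G (Finset.mem_filter.1 hG).2
    _ ≤ ∑ S ∈ (allPairs V).powerset, F S := sum_graphs_le_sum_powerset hF0 I
    _ = s * ∏ e ∈ allPairs V, (f e + g e) := by
        simp only [hF]
        rw [← Finset.mul_sum, Finset.prod_add]
    _ = _ := by rw [hprod]

lemma one_add_mul_pow_le_exp {x : ℝ} (hx : 0 ≤ 1 + x) (n : ℕ) :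
    (1 + x) ^ n ≤ Real.exp (x * n) := by
  rw [mul_comm, Real.exp_nat_mul]
  exact pow_le_pow_left₀ hx (by linarith [Real.add_one_le_exp x]) n

/-- Lower tail. -/
theorem binomialRandom_real_le_exp_lower (p : unitInterval) {A B : Finset (Sym2 V)}
    (hA : A ⊆ allPairs V) (hB : B ⊆ allPairs V) (hAB : Disjoint A B) {l r : ℝ} (hl : 0 ≤ l)
    (Q : Set (SimpleGraph V)) (hQA : ∀ G ∈ Q, (A : Set (Sym2 V)) ⊆ G.edgeSet)
    (hQB : ∀ G ∈ Q, ((G.edgesIn B).card : ℝ) ≤ r) :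
    (binomialRandom V p).real Q ≤
      (p : ℝ) ^ A.card * Real.exp (l * r - (1 - Real.exp (-l)) * p * B.card) := by
  have hp0 : (0 : ℝ) ≤ p := p.2.1
  have hp1 : (p : ℝ) ≤ 1 := p.2.2
  have h := binomialRandom_real_le p hA hB hAB (Real.exp_pos (l * r)).le (Real.exp_pos (-l)).le Q
    hQA (fun G hG => by
      rw [← Real.exp_nat_mul, ← Real.exp_add]
      refine Real.one_le_exp ?_
      have := mul_le_mul_of_nonneg_left (hQB G hG) hl
      linarith)
  refine h.trans ?_
  have h1 : (1 + (Real.exp (-l) - 1) * p) ^ B.card ≤ Real.exp ((Real.exp (-l) - 1) * p * B.card) :=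
    one_add_mul_pow_le_exp (by nlinarith [Real.exp_pos (-l)]) _
  calc Real.exp (l * r) * ((p : ℝ) ^ A.card * (1 + (Real.exp (-l) - 1) * p) ^ B.card)
      ≤ Real.exp (l * r) * ((p : ℝ) ^ A.card * Real.exp ((Real.exp (-l) - 1) * p * B.card)) := by
        gcongr
    _ = (p : ℝ) ^ A.card * (Real.exp (l * r) * Real.exp ((Real.exp (-l) - 1) * p * B.card)) := by
        ring
    _ = _ := by rw [← Real.exp_add]; ring_nf

/-- Upper tail. -/
theorem binomialRandom_real_le_exp_upper (p : unitInterval) {B : Finset (Sym2 V)}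
    (hB : B ⊆ allPairs V) {l r : ℝ} (hl : 0 ≤ l)
    (Q : Set (SimpleGraph V)) (hQB : ∀ G ∈ Q, r ≤ ((G.edgesIn B).card : ℝ)) :
    (binomialRandom V p).real Q ≤ Real.exp ((Real.exp l - 1) * p * B.card - l * r) := by
  have hp0 : (0 : ℝ) ≤ p := p.2.1
  have hexp : 1 ≤ Real.exp l := Real.one_le_exp hl
  have h := binomialRandom_real_le p (Finset.empty_subset _) hB (Finset.disjoint_empty_left _)
    (Real.exp_pos (-(l * r))).le (Real.exp_pos l).le Q (by simp) (fun G hG => by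
      rw [← Real.exp_nat_mul, ← Real.exp_add]
      refine Real.one_le_exp ?_
      have := mul_le_mul_of_nonneg_left (hQB G hG) hl
      linarith)
  refine h.trans ?_
  rw [Finset.card_empty, pow_zero, one_mul]
  have h1 : (1 + (Real.exp l - 1) * p) ^ B.card ≤ Real.exp ((Real.exp l - 1) * p * B.card) :=
    one_add_mul_pow_le_exp (by nlinarith) _
  calc Real.exp (-(l * r)) * (1 + (Real.exp l - 1) * p) ^ B.card
      ≤ Real.exp (-(l * r)) * Real.exp ((Real.exp l - 1) * p * B.card) := by gcongr
    _ = _ := by rw [← Real.exp_add]; ring_nf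

/-- The union bound over a finite family. -/
lemma binomialRandom_real_le_sum (p : unitInterval) {ι : Type*} (I : Finset ι)
    (Q : Set (SimpleGraph V)) (E : ι → Set (SimpleGraph V)) (hQ : ∀ G ∈ Q, ∃ i ∈ I, G ∈ E i)
    {f : ι → ℝ} (hf : ∀ i ∈ I, (binomialRandom V p).real (E i) ≤ f i) :
    (binomialRandom V p).real Q ≤ ∑ i ∈ I, f i := by
  calc (binomialRandom V p).real Q ≤ (binomialRandom V p).real (⋃ i ∈ I, E i) := by
        refine measureReal_mono (fun G hG => ?_) (measure_ne_top _ _)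
        obtain ⟨i, hi, h⟩ := hQ G hG
        exact Set.mem_biUnion hi h
    _ ≤ ∑ i ∈ I, (binomialRandom V p).real (E i) := measureReal_biUnion_finset_le _ _
    _ ≤ _ := Finset.sum_le_sum hf

lemma sum_powerset_pow_card {α : Type*} [DecidableEq α] (s : Finset α) (x : ℝ) :
    ∑ S ∈ s.powerset, x ^ S.card = (1 + x) ^ s.card := by
  have := Finset.prod_add (fun _ : α => x) (fun _ => 1) s
  simp only [Finset.prod_const, one_pow, mul_one] at this
  rw [← this, add_comm]

end SimpleGraph

/-! ### Probabilities of the exceptional events. -/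

namespace SimpleGraph

open MeasureTheory

variable {V : Type*} [Fintype V] [DecidableEq V] {G : SimpleGraph V}

lemma card_allPairs_le : ((allPairs V).card : ℝ) ≤ (Fintype.card V : ℝ) ^ 2 / 2 := by
  rw [card_allPairs, Nat.cast_choose_two]
  nlinarith [(Nat.cast_nonneg (Fintype.card V) : (0 : ℝ) ≤ _)]

lemma innerPairs_subset (X : Finset V) : innerPairs X ⊆ allPairs V := by
  intro e he
  rw [mem_allPairs]
  exact (Finset.mem_filter.1 he).2

lemma card_innerPairs_le (X : Finset V) : (innerPairs X).card ≤ X.card ^ 2 := by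
  have : innerPairs X ⊆ crossPairs X X := by
    intro e he
    induction e with | h u v =>
    rw [mk_mem_innerPairs] at he
    exact mem_crossPairs.2 ⟨u, he.1.1, v, he.1.2, rfl⟩
  refine (Finset.card_le_card this).trans (Finset.card_image_le.trans ?_)
  rw [Finset.card_product, sq]

lemma crossPairs_subset {A B : Finset V} (h : Disjoint A B) : crossPairs A B ⊆ allPairs V := by
  intro e he
  obtain ⟨a, ha, b, hb, rfl⟩ := mem_crossPairs.1 he
  rw [mem_allPairs, Sym2.mk_isDiag_iff]
  rintro rfl
  exact Finset.disjoint_left.1 h ha hb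

lemma card_crossPairs {A B : Finset V} (h : Disjoint A B) :
    (crossPairs A B).card = A.card * B.card := by
  rw [crossPairs, Finset.card_image_of_injOn, Finset.card_product]
  rintro ⟨a, b⟩ hab ⟨a', b'⟩ hab' he
  rw [Finset.mem_coe, Finset.mem_product] at hab hab'
  rcases Sym2.eq_iff.1 he with ⟨h1, h2⟩ | ⟨h1, h2⟩
  · exact Prod.ext h1 h2
  · exact absurd (h1 ▸ hab.1) (fun h' => Finset.disjoint_left.1 h h' hab'.2)

lemma boosters_subset : G.boosters ⊆ allPairs V := by
  intro e he
  rw [mem_allPairs]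
  exact (mem_boosters.1 he).2.1

lemma half_le_one_sub_exp_neg_one : (1 / 2 : ℝ) ≤ 1 - Real.exp (-1) := by
  have := Real.exp_neg_one_lt_d9
  linarith

/-- A random graph is unlikely to have many more edges than expected. -/
lemma binomialRandom_real_many_edges (p : unitInterval) :
    (binomialRandom V p).real {G | 2 * (Fintype.card V * (Fintype.card V * p : ℝ)) <
      G.edgeSet.ncard} ≤ Real.exp (-(Fintype.card V * (Fintype.card V * p : ℝ))) := by
  have hp0 : (0 : ℝ) ≤ p := p.2.1
  refine (binomialRandom_real_le_exp_upper p (Finset.Subset.refl (allPairs V)) (l := 1)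
    (r := 2 * (Fintype.card V * (Fintype.card V * p : ℝ))) zero_le_one _ ?_).trans ?_
  · intro G hG
    rw [edgesIn_allPairs_eq_univ, ← ncard_edgeSet_eq]
    exact le_of_lt hG
  · rw [Real.exp_le_exp]
    have h1 := Real.exp_one_lt_d9
    have h2 := card_allPairs_le (V := V)
    have h3 : (Real.exp 1 - 1) * p * (allPairs V).card ≤
        2 * p * ((Fintype.card V : ℝ) ^ 2 / 2) := by
      have : (0 : ℝ) ≤ Real.exp 1 - 1 := by linarith [Real.exp_one_gt_d9]
      gcongr
      linarith
    nlinarith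

/-- A random graph is unlikely to have isolated vertices. -/
lemma binomialRandom_real_minDeg_eq_zero [Nonempty V] (p : unitInterval) :
    (binomialRandom V p).real {G | G.minDeg = 0} ≤
      Fintype.card V * Real.exp (-(p * (Fintype.card V - 1 : ℝ))) := by
  have hp1 : (p : ℝ) ≤ 1 := p.2.2
  have h := binomialRandom_real_le_sum p (Finset.univ : Finset V) {G | G.minDeg = 0}
    (fun v => {G | (G.nbrs v).card = 0})
    (f := fun _ => Real.exp (-(p * (Fintype.card V - 1 : ℝ)))) (by
      intro G hG
      obtain ⟨v, hv⟩ := G.exists_card_nbrs_eq_minDeg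
      exact ⟨v, Finset.mem_univ _, hv.trans hG⟩) (by
      intro v _
      have hdis : Disjoint {v} (Finset.univ.erase v) := by simp
      have h1 := binomialRandom_real_le p (Finset.empty_subset _)
        (crossPairs_subset hdis) (Finset.disjoint_empty_left _)
        -- With t = 0 the weight t^e is 1 exactly when e = 0, so this gives the bound (1 - p)^(n -
        -- 1) for isolation.
        (s := 1) (t := 0) zero_le_one le_rfl {G | (G.nbrs v).card = 0} (by simp) (by
          intro G hG
          have : G.edgesIn (crossPairs {v} (Finset.univ.erase v)) = ∅ := by
            refine Finset.eq_empty_of_forall_notMem fun e he => ?_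
            rw [mem_edgesIn, mem_crossPairs] at he
            obtain ⟨⟨a, ha, w, -, rfl⟩, hadj⟩ := he
            rw [Finset.mem_singleton] at ha
            subst ha
            have : w ∈ G.nbrs a := mem_nbrs.2 hadj
            rw [Finset.card_eq_zero.1 hG] at this
            simp at this
          rw [this]
          simp)
      refine h1.trans ?_
      rw [card_crossPairs hdis, Finset.card_empty, Finset.card_singleton,
        Finset.card_erase_of_mem (Finset.mem_univ v), Finset.card_univ]
      simp only [one_mul, pow_zero]
      refine (one_add_mul_pow_le_exp (by linarith) _).trans ?_
      rw [Real.exp_le_exp, Nat.cast_sub Fintype.card_pos]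
      simp)
  refine h.trans ?_
  rw [Finset.sum_const, nsmul_eq_mul, Finset.card_univ]

/-- Small sets of vertices of a random graph span few edges. -/
lemma binomialRandom_real_not_sparse (p : unitInterval) {k q B₀ : ℕ} (hq : 0 < q) {l z : ℝ}
    (hl : 0 ≤ l) (hz : (Real.exp l - 1) * p * B₀ - l * (k / q) ≤ -z) :
    (binomialRandom V p).real {G | ∃ X : Finset V, X.card ≤ B₀ ∧
      k * X.card < q * (G.edgesIn (innerPairs X)).card} ≤
      Real.exp (Real.exp (-z) * Fintype.card V) - 1 := by
  have hp0 : (0 : ℝ) ≤ p := p.2.1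
  have hexp : 0 ≤ Real.exp l - 1 := sub_nonneg.2 (Real.one_le_exp hl)
  have h := binomialRandom_real_le_sum p
    ((Finset.univ : Finset V).powerset.erase ∅) {G | ∃ X : Finset V, X.card ≤ B₀ ∧
      k * X.card < q * (G.edgesIn (innerPairs X)).card}
    (fun X => {G | X.card ≤ B₀ ∧ k * X.card < q * (G.edgesIn (innerPairs X)).card})
    -- `X` spans at most |X| B₀ pairs, so the tail exponent is linear in |X| and the union bound
    -- sums to (1 + e^(-z))^n - 1.
    (f := fun X => Real.exp (-z) ^ X.card) (by
      rintro G ⟨X, hX, hX'⟩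
      refine ⟨X, ?_, hX, hX'⟩
      rw [Finset.mem_erase]
      refine ⟨?_, by simp⟩
      rintro rfl
      have : G.edgesIn (innerPairs ∅) = ∅ := by simp [edgesIn, innerPairs]
      rw [this] at hX'
      simp at hX') (by
      intro X _
      by_cases hX : X.card ≤ B₀
      swap
      · simp only [hX, false_and, Set.ofPred_false, measureReal_empty]
        positivity
      refine (binomialRandom_real_le_exp_upper p (innerPairs_subset X) hl
        (r := k * X.card / q) _ ?_).trans ?_
      · rintro G ⟨-, hG⟩
        rw [div_le_iff₀ (by exact_mod_cast hq)]
        have : (k * X.card : ℝ) < q * (G.edgesIn (innerPairs X)).card := by exact_mod_cast hG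
        linarith
      · rw [← Real.exp_nat_mul, Real.exp_le_exp]
        have h1 : ((innerPairs X).card : ℝ) ≤ X.card * B₀ := by
          have : (innerPairs X).card ≤ X.card * B₀ :=
            (card_innerPairs_le X).trans (by rw [sq]; exact Nat.mul_le_mul_left _ hX)
          exact_mod_cast this
        calc (Real.exp l - 1) * p * (innerPairs X).card - l * (k * X.card / q)
            ≤ (Real.exp l - 1) * p * (X.card * B₀) - l * (k * X.card / q) := by gcongr
          _ = X.card * ((Real.exp l - 1) * p * B₀ - l * (k / q)) := by ring
          _ ≤ X.card * -z := by gcongr)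
  refine h.trans ?_
  have h1 := Finset.sum_erase_eq_sub (s := (Finset.univ : Finset V).powerset) (a := ∅)
    (f := fun X : Finset V => Real.exp (-z) ^ X.card) (by simp)
  rw [h1, sum_powerset_pow_card, Finset.card_univ, Finset.card_empty, pow_zero]
  have := one_add_mul_pow_le_exp (x := Real.exp (-z)) (by positivity) (Fintype.card V)
  linarith

/-- Large disjoint sets of vertices of a random graph are joined by many edges. -/
lemma binomialRandom_real_not_join (p : unitInterval) (b : ℕ) (r : ℝ) :
    (binomialRandom V p).real {G | ∃ A B : Finset V, Disjoint A B ∧ b ≤ A.card ∧ b ≤ B.card ∧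
      ((G.edgesIn (crossPairs A B)).card : ℝ) ≤ r} ≤
      4 ^ Fintype.card V * Real.exp (r - p * b ^ 2 / 2) := by
  have hp0 : (0 : ℝ) ≤ p := p.2.1
  have h := binomialRandom_real_le_sum p (Finset.univ : Finset (Finset V × Finset V))
    {G | ∃ A B : Finset V, Disjoint A B ∧ b ≤ A.card ∧ b ≤ B.card ∧
      ((G.edgesIn (crossPairs A B)).card : ℝ) ≤ r}
    (fun x => {G | (Disjoint x.1 x.2 ∧ b ≤ x.1.card ∧ b ≤ x.2.card) ∧
      ((G.edgesIn (crossPairs x.1 x.2)).card : ℝ) ≤ r})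
    (f := fun _ => Real.exp (r - p * b ^ 2 / 2)) (by
      rintro G ⟨A, B, h1, h2, h3, h4⟩
      exact ⟨(A, B), Finset.mem_univ _, ⟨h1, h2, h3⟩, h4⟩) (by
      rintro ⟨A, B⟩ _
      by_cases hc : Disjoint A B ∧ b ≤ A.card ∧ b ≤ B.card
      swap
      · simp only [hc, false_and, Set.ofPred_false, measureReal_empty]
        positivity
      refine (binomialRandom_real_le_exp_lower p (Finset.empty_subset _)
        (crossPairs_subset hc.1) (Finset.disjoint_empty_left _) (l := 1) (r := r) zero_le_one _
        (by simp) (fun G hG => hG.2)).trans ?_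
      rw [Finset.card_empty, pow_zero, one_mul, Real.exp_le_exp, card_crossPairs hc.1, one_mul]
      have h1 : (b : ℝ) ^ 2 ≤ ((A.card * B.card : ℕ) : ℝ) := by
        have : b ^ 2 ≤ A.card * B.card := by rw [sq]; exact Nat.mul_le_mul hc.2.1 hc.2.2
        exact_mod_cast this
      have h2 : (1 / 2 : ℝ) * p * b ^ 2 ≤ (1 - Real.exp (-1)) * p * (A.card * B.card : ℕ) := by
        have := half_le_one_sub_exp_neg_one
        gcongr
      linarith)
  refine h.trans (le_of_eq ?_)
  rw [Finset.sum_const, nsmul_eq_mul, Finset.card_univ, Fintype.card_prod, Fintype.card_finset,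
    ← mul_pow]
  norm_num

/-- Two vertices of a random graph have few common neighbours. -/
lemma binomialRandom_real_codeg (p : unitInterval) (c : ℕ) :
    (binomialRandom V p).real {G | ∃ u v, u ≠ v ∧ c < (G.nbrs u ∩ G.nbrs v).card} ≤
      (Fintype.card V : ℝ) ^ 2 * ((p : ℝ) ^ (c + 1) * Real.exp (p * Fintype.card V)) := by
  have hp0 : (0 : ℝ) ≤ p := p.2.1
  have h := binomialRandom_real_le_sum p
    ((Finset.univ : Finset (V × V)) ×ˢ (Finset.univ : Finset V).powerset)
    {G | ∃ u v, u ≠ v ∧ c < (G.nbrs u ∩ G.nbrs v).card}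
    (fun x => {G | (x.1.1 ≠ x.1.2 ∧ Disjoint {x.1.1, x.1.2} x.2 ∧ x.2.card = c + 1) ∧
      (crossPairs {x.1.1, x.1.2} x.2 : Set (Sym2 V)) ⊆ G.edgeSet})
    -- The probability p^(2(c + 1)) is split so that the sum over all sets `W` becomes (1 + p)^n,
    -- which avoids binomial coefficients.
    (f := fun x => (p : ℝ) ^ (c + 1) * (p : ℝ) ^ x.2.card) (by
      rintro G ⟨u, v, huv, hc⟩
      obtain ⟨W, hW, hWc⟩ := Finset.exists_subset_card_eq (Nat.succ_le_of_lt hc)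
      have hWadj : ∀ w ∈ W, G.Adj u w ∧ G.Adj v w := fun w hw => by
        have := hW hw
        rwa [Finset.mem_inter, mem_nbrs, mem_nbrs] at this
      refine ⟨((u, v), W), by simp, ⟨huv, ?_, hWc⟩, ?_⟩
      · rw [Finset.disjoint_left]
        intro w hw hwW
        have := hWadj w hwW
        simp only [Finset.mem_insert, Finset.mem_singleton] at hw
        rcases hw with rfl | rfl
        · exact G.irrefl this.1
        · exact G.irrefl this.2
      · intro e he
        obtain ⟨a, ha, w, hw, rfl⟩ := mem_crossPairs.1 (Finset.mem_coe.1 he)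
        have := hWadj w hw
        simp only [Finset.mem_insert, Finset.mem_singleton] at ha
        rcases ha with rfl | rfl
        · exact this.1
        · exact this.2) (by
      rintro ⟨⟨u, v⟩, W⟩ _
      by_cases hc : u ≠ v ∧ Disjoint {u, v} W ∧ W.card = c + 1
      swap
      · simp only [hc, false_and, Set.ofPred_false, measureReal_empty]
        positivity
      have h1 := binomialRandom_real_le p (crossPairs_subset hc.2.1) (Finset.empty_subset _)
        (Finset.disjoint_empty_right _) (s := 1) (t := 1) zero_le_one zero_le_one
        {G | (u ≠ v ∧ Disjoint {u, v} W ∧ W.card = c + 1) ∧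
          (crossPairs {u, v} W : Set (Sym2 V)) ⊆ G.edgeSet} (fun G hG => hG.2) (by simp)
      refine h1.trans (le_of_eq ?_)
      rw [card_crossPairs hc.2.1, Finset.card_pair hc.1, hc.2.2]
      simp
      ring)
  refine h.trans ?_
  rw [Finset.sum_product]
  simp only [← Finset.mul_sum, sum_powerset_pow_card, Finset.sum_const, nsmul_eq_mul,
    Finset.card_univ, Fintype.card_prod]
  have := one_add_mul_pow_le_exp (x := (p : ℝ)) (by positivity) (Fintype.card V)
  rw [Nat.cast_mul, ← sq, mul_left_comm]
  gcongr

/-- Sparse subgraphs of a random graph with quadratically many boosters have many boosters in the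
random graph. -/
lemma binomialRandom_real_few_boosters (p : unitInterval) (m : ℕ) (r : ℝ) :
    (binomialRandom V p).real {G | ∃ Γ ≤ G, Γ.edgeSet.ncard ≤ m ∧
      Fintype.card V ^ 2 ≤ 32 * Γ.boosters.card ∧ ((G.edgesIn Γ.boosters).card : ℝ) ≤ r} ≤
      Real.exp (r + 5 * m - p * (Fintype.card V : ℝ) ^ 2 / 100) := by
  have hp0 : (0 : ℝ) ≤ p := p.2.1
  classical
  set n : ℝ := Nat.cast (Fintype.card V) with hn
  have h := binomialRandom_real_le_sum p (Finset.univ : Finset (SimpleGraph V))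
    {G | ∃ Γ ≤ G, Γ.edgeSet.ncard ≤ m ∧
      Fintype.card V ^ 2 ≤ 32 * Γ.boosters.card ∧ ((G.edgesIn Γ.boosters).card : ℝ) ≤ r}
    (fun Γ => {G | (Γ.edgeSet.ncard ≤ m ∧ Fintype.card V ^ 2 ≤ 32 * Γ.boosters.card) ∧ Γ ≤ G ∧
      ((G.edgesIn Γ.boosters).card : ℝ) ≤ r})
    -- Since e(Γ) ≤ m, a factor e^(5m) can be traded for e^(-5 e(Γ)). The sum over Γ is then at most
    -- exp(pn²/200), less than the gain exp(pn²/64) from the boosters.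
    (f := fun Γ => Real.exp (r + 5 * m - p * n ^ 2 / 64) *
      (Real.exp (-5) * p) ^ (Γ.edgesIn (allPairs V)).card) (by
      rintro G ⟨Γ, h1, h2, h3, h4⟩
      exact ⟨Γ, Finset.mem_univ _, ⟨h2, h3⟩, h1, h4⟩) (by
      intro Γ _
      by_cases hc : Γ.edgeSet.ncard ≤ m ∧ Fintype.card V ^ 2 ≤ 32 * Γ.boosters.card
      swap
      · simp only [hc, false_and, Set.ofPred_false, measureReal_empty]
        positivity
      have hdis : Disjoint (Γ.edgesIn (allPairs V)) Γ.boosters := by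
        rw [Finset.disjoint_left]
        intro e he he'
        exact (mem_boosters.1 he').1 (mem_edgesIn.1 he).2
      refine (binomialRandom_real_le_exp_lower p (edgesIn_subset (G := Γ)) boosters_subset hdis
        (l := 1) (r := r) zero_le_one _ (fun G hG e he => ?_) (fun G hG => hG.2.2)).trans ?_
      · exact edgeSet_mono hG.2.1 (mem_edgesIn.1 he).2
      · have hcm : (Γ.edgesIn (allPairs V)).card ≤ m := by
          rw [edgesIn_allPairs_eq_univ, ← ncard_edgeSet_eq]; exact hc.1
        set j := (Γ.edgesIn (allPairs V)).card
        have h1 : n ^ 2 / 32 ≤ Γ.boosters.card := by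
          have : n ^ 2 ≤ 32 * Γ.boosters.card := by rw [hn]; exact_mod_cast hc.2
          linarith
        have h2 : (1 / 2 : ℝ) * p * (n ^ 2 / 32) ≤
            (1 - Real.exp (-1)) * p * Γ.boosters.card := by
          have := half_le_one_sub_exp_neg_one
          gcongr
        have h3 : (j : ℝ) ≤ m := by exact_mod_cast hcm
        rw [mul_pow, ← Real.exp_nat_mul, mul_comm, ← mul_assoc, ← Real.exp_add]
        gcongr
        linarith)
  refine h.trans ?_
  rw [← Finset.mul_sum]
  have h1 := sum_graphs_le_sum_powerset (V := V)
    (f := fun S => (Real.exp (-5) * (p : ℝ)) ^ S.card) (fun S => by positivity) Finset.univ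
  rw [sum_powerset_pow_card] at h1
  have h2 := one_add_mul_pow_le_exp (x := Real.exp (-5) * p) (by positivity) (allPairs V).card
  have h3 : Real.exp (-5) * p * (allPairs V).card ≤ (1 / 100) * p * (n ^ 2 / 2) := by
    have h4 : Real.exp (-5) ≤ 1 / 100 := by
      have e1 : Real.exp (-5) = Real.exp (-1) ^ 5 := by rw [← Real.exp_nat_mul]; norm_num
      have e2 := Real.exp_neg_one_lt_d9
      rw [e1]
      calc Real.exp (-1) ^ 5 ≤ 0.3678794412 ^ 5 :=
            pow_le_pow_left₀ (Real.exp_pos _).le e2.le 5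
        _ ≤ 1 / 100 := by norm_num
    have h5 := card_allPairs_le (V := V)
    gcongr
  calc Real.exp (r + 5 * m - p * n ^ 2 / 64) *
        ∑ Γ : SimpleGraph V, (Real.exp (-5) * (p : ℝ)) ^ (Γ.edgesIn (allPairs V)).card
      ≤ Real.exp (r + 5 * m - p * n ^ 2 / 64) * Real.exp ((1 / 100) * p * (n ^ 2 / 2)) := by
        gcongr
        exact h1.trans (h2.trans (Real.exp_le_exp.2 h3))
    _ ≤ _ := by
        rw [← Real.exp_add, Real.exp_le_exp]
        have : 0 ≤ p * n ^ 2 := by positivity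
        nlinarith

/-- A random graph has few short paths whose ends both have low degree. -/
lemma binomialRandom_real_path (p : unitInterval) (ℓ k : ℕ) (hℓ : 1 ≤ ℓ) :
    (binomialRandom V p).real {G | ∃ u v, (G.nbrs u).card < 4 * k ∧ (G.nbrs v).card < 4 * k ∧
      ∃ w : G.Walk u v, w.IsPath ∧ w.length = ℓ} ≤
      (Fintype.card V : ℝ) ^ (ℓ + 1) * ((p : ℝ) ^ ℓ *
        Real.exp (24 * k - 1.8 * p * (Fintype.card V - (ℓ + 1)))) := by
  classical
  have hp0 : (0 : ℝ) ≤ p := p.2.1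
  set A : (Fin (ℓ + 1) → V) → Finset (Sym2 V) := fun f =>
    Finset.univ.image fun i : Fin ℓ => s(f i.castSucc, f i.succ) with hA
  -- Pairs from the two ends to vertices off the path: disjoint from the path's edges, hence
  -- independent of them.
  set B : (Fin (ℓ + 1) → V) → Finset (Sym2 V) := fun f =>
    crossPairs {f 0, f (Fin.last ℓ)} (Finset.univ.image f)ᶜ with hB
  have h := binomialRandom_real_le_sum p (Finset.univ : Finset (Fin (ℓ + 1) → V))
    {G | ∃ u v, (G.nbrs u).card < 4 * k ∧ (G.nbrs v).card < 4 * k ∧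
      ∃ w : G.Walk u v, w.IsPath ∧ w.length = ℓ}
    (fun f => {G | Function.Injective f ∧ (A f : Set (Sym2 V)) ⊆ G.edgeSet ∧
      ((G.edgesIn (B f)).card : ℝ) ≤ 8 * k})
    (f := fun _ => (p : ℝ) ^ ℓ * Real.exp (24 * k - 1.8 * p * (Fintype.card V - (ℓ + 1)))) (by
      rintro G ⟨u, v, hu, hv, w, hw, rfl⟩
      refine ⟨fun i => w.getVert i, Finset.mem_univ _, ?_, ?_, ?_⟩
      · intro i j hij
        exact Fin.ext (hw.getVert_injOn (Nat.lt_succ_iff.1 i.2) (Nat.lt_succ_iff.1 j.2) hij)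
      · intro e he
        rw [hA, Finset.mem_coe, Finset.mem_image] at he
        obtain ⟨i, -, rfl⟩ := he
        exact w.adj_getVert_succ i.2
      · have hsub : G.edgesIn (B fun i => w.getVert i) ⊆
            (G.nbrs u).image (fun x => s(u, x)) ∪ (G.nbrs v).image (fun x => s(v, x)) := by
          intro e he
          rw [mem_edgesIn, hB, mem_crossPairs] at he
          obtain ⟨⟨a, ha, x, -, rfl⟩, hadj⟩ := he
          simp only [Finset.mem_insert, Finset.mem_singleton, Fin.val_zero, Walk.getVert_zero,
            Fin.val_last, Walk.getVert_length] at ha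
          rw [Finset.mem_union, Finset.mem_image, Finset.mem_image]
          rcases ha with rfl | rfl
          · exact Or.inl ⟨x, mem_nbrs.2 hadj, rfl⟩
          · exact Or.inr ⟨x, mem_nbrs.2 hadj, rfl⟩
        have h1 := (Finset.card_le_card hsub).trans (Finset.card_union_le _ _)
        have h2 := Finset.card_image_le (s := G.nbrs u) (f := fun x => s(u, x))
        have h3 := Finset.card_image_le (s := G.nbrs v) (f := fun x => s(v, x))
        have h4 : (G.edgesIn (B fun i => w.getVert i)).card ≤ 8 * k := by omega
        exact_mod_cast h4) (by
      intro f _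
      by_cases hf : Function.Injective f
      swap
      · simp only [hf, false_and, Set.ofPred_false, measureReal_empty]
        positivity
      have hends : f 0 ≠ f (Fin.last ℓ) := by
        intro hc
        have := congrArg Fin.val (hf hc)
        simp at this
        omega
      have hAc : (A f).card = ℓ := by
        rw [hA, Finset.card_image_of_injective, Finset.card_univ, Fintype.card_fin]
        intro i j hij
        rcases Sym2.eq_iff.1 hij with ⟨h1, -⟩ | ⟨h1, h2⟩
        · exact Fin.castSucc_injective _ (hf h1)
        · have e1 := congrArg Fin.val (hf h1)
          have e2 := congrArg Fin.val (hf h2)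
          simp at e1 e2
          omega
      have hXdis : Disjoint {f 0, f (Fin.last ℓ)} (Finset.univ.image f)ᶜ := by
        rw [Finset.disjoint_left]
        intro x hx hx'
        rw [Finset.mem_compl] at hx'
        simp only [Finset.mem_insert, Finset.mem_singleton] at hx
        rcases hx with rfl | rfl <;> exact hx' (Finset.mem_image_of_mem _ (Finset.mem_univ _))
      have hBc : ((B f).card : ℝ) = 2 * (Fintype.card V - (ℓ + 1)) := by
        have h1 : (Finset.univ.image f).card = ℓ + 1 := by
          rw [Finset.card_image_of_injective _ hf, Finset.card_univ, Fintype.card_fin]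
        have h2 : ℓ + 1 ≤ Fintype.card V := h1 ▸ Finset.card_le_univ _
        rw [hB, card_crossPairs hXdis, Finset.card_pair hends, Finset.card_compl, h1]
        push_cast [h2]
        ring
      have hAsub : A f ⊆ allPairs V := by
        intro e he
        obtain ⟨i, -, rfl⟩ := Finset.mem_image.1 he
        rw [mem_allPairs, Sym2.mk_isDiag_iff]
        intro hc
        have := congrArg Fin.val (hf hc)
        simp at this
      have hdis : Disjoint (A f) (B f) := by
        rw [Finset.disjoint_left]
        intro e he he'
        obtain ⟨i, -, rfl⟩ := Finset.mem_image.1 he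
        obtain ⟨a, -, x, hx, hax⟩ := mem_crossPairs.1 he'
        rw [Finset.mem_compl] at hx
        rcases Sym2.eq_iff.1 hax with ⟨-, h2⟩ | ⟨-, h2⟩
        · exact hx (h2 ▸ Finset.mem_image_of_mem _ (Finset.mem_univ _))
        · exact hx (h2 ▸ Finset.mem_image_of_mem _ (Finset.mem_univ _))
      -- With l = 3 the rate is 1 - e^(-3) ≥ 0.9 per expected edge. Two ends give 1.8 pn, enough to
      -- beat the factor n left by the union bound.
      refine (binomialRandom_real_le_exp_lower p hAsub (crossPairs_subset hXdis) hdis (l := 3)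
        (r := 8 * k) (by norm_num) _ (fun G hG => hG.2.1) (fun G hG => hG.2.2)).trans ?_
      rw [hAc]
      have he : Real.exp (-3) ≤ 0.1 := by
        have e1 : Real.exp (-3) = Real.exp (-1) ^ 3 := by rw [← Real.exp_nat_mul]; norm_num
        rw [e1]
        calc Real.exp (-1) ^ 3 ≤ 0.3678794412 ^ 3 :=
              pow_le_pow_left₀ (Real.exp_pos _).le Real.exp_neg_one_lt_d9.le 3
          _ ≤ 0.1 := by norm_num
      have h0 : (0 : ℝ) ≤ p * (B f).card := by positivity
      refine mul_le_mul_of_nonneg_left (Real.exp_le_exp.2 ?_) (by positivity)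
      have h1 : 0.9 * (p * (B f).card : ℝ) ≤ (1 - Real.exp (-3)) * (p * (B f).card) := by
        gcongr
        linarith
      have h2 : 0.9 * (p * (B f).card : ℝ) = 1.8 * p * (Fintype.card V - (ℓ + 1)) := by
        rw [hBc]; ring
      linarith)
  refine h.trans (le_of_eq ?_)
  rw [Finset.sum_const, nsmul_eq_mul, Finset.card_univ, Fintype.card_fun, Fintype.card_fin]
  push_cast
  ring

/-- Vertices of low degree in a random graph are far apart. -/
lemma binomialRandom_real_small_near (p : unitInterval) (k : ℕ)
    (hd : 1 ≤ (Fintype.card V * p : ℝ)) :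
    (binomialRandom V p).real {G | ∃ u v, u ≠ v ∧ (G.nbrs u).card < 4 * k ∧
      (G.nbrs v).card < 4 * k ∧ ∃ w : G.Walk u v, w.length ≤ 4} ≤
      4 * (Fintype.card V * ((Fintype.card V * p : ℝ) ^ 4 *
        Real.exp (24 * k - 1.8 * (Fintype.card V * p) + 9))) := by
  have hp0 : (0 : ℝ) ≤ p := p.2.1
  have hp1 : (p : ℝ) ≤ 1 := p.2.2
  have h := binomialRandom_real_le_sum p (Finset.Icc 1 4)
    {G | ∃ u v, u ≠ v ∧ (G.nbrs u).card < 4 * k ∧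
      (G.nbrs v).card < 4 * k ∧ ∃ w : G.Walk u v, w.length ≤ 4}
    (fun ℓ => {G : SimpleGraph V | ∃ u v, (G.nbrs u).card < 4 * k ∧ (G.nbrs v).card < 4 * k ∧
      ∃ w : G.Walk u v, w.IsPath ∧ w.length = ℓ})
    (f := fun _ => Fintype.card V * ((Fintype.card V * p : ℝ) ^ 4 *
        Real.exp (24 * k - 1.8 * (Fintype.card V * p) + 9))) (by
      rintro G ⟨u, v, huv, hu, hv, w, hw⟩
      refine ⟨w.bypass.length, Finset.mem_Icc.2 ⟨?_, w.length_bypass_le_length.trans hw⟩, u, v, hu, hv,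
        w.bypass, w.bypass_isPath, rfl⟩
      by_contra hc
      exact huv (Walk.eq_of_length_eq_zero (by omega : w.bypass.length = 0))) (by
      intro ℓ hℓ
      rw [Finset.mem_Icc] at hℓ
      refine (binomialRandom_real_path p ℓ k hℓ.1).trans ?_
      have hℓ4 : (ℓ : ℝ) ≤ 4 := by exact_mod_cast hℓ.2
      have h1 : (Fintype.card V * p : ℝ) ^ ℓ ≤ (Fintype.card V * p : ℝ) ^ 4 :=
        pow_le_pow_right₀ hd hℓ.2
      calc (Fintype.card V : ℝ) ^ (ℓ + 1) * ((p : ℝ) ^ ℓ *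
            Real.exp (24 * k - 1.8 * p * (Fintype.card V - (ℓ + 1))))
          = Fintype.card V * ((Fintype.card V * p : ℝ) ^ ℓ *
            Real.exp (24 * k - 1.8 * p * (Fintype.card V - (ℓ + 1)))) := by
            rw [mul_pow]; ring
        _ ≤ _ := by
            gcongr
            nlinarith)
  refine h.trans (le_of_eq ?_)
  rw [Finset.sum_const, nsmul_eq_mul, Nat.card_Icc]
  norm_num

end SimpleGraph

/-! ### Choice of constants and the total error. -/

namespace SimpleGraph

open MeasureTheory

section Resilience

variable {V : Type*} [Fintype V] [DecidableEq V] {G : SimpleGraph V}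

lemma minDeg_le_of_card_edges [Nonempty V] {d : ℝ}
    (h : (G.edgeSet.ncard : ℝ) ≤ 2 * (Fintype.card V * d)) : (G.minDeg : ℝ) ≤ 4 * d := by
  have h1 : Fintype.card V * G.minDeg ≤ 2 * G.edgeSet.ncard := by
    refine le_trans ?_ (G.sum_card_nbrs_le Finset.univ)
    rw [← Finset.card_univ, ← smul_eq_mul, ← Finset.sum_const]
    exact Finset.sum_le_sum fun v _ => G.minDeg_le_card_nbrs v
  have h2 : (Fintype.card V * G.minDeg : ℝ) ≤ 2 * G.edgeSet.ncard := by exact_mod_cast h1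
  have h3 : (0 : ℝ) < Fintype.card V := by exact_mod_cast Fintype.card_pos
  refine le_of_mul_le_mul_left ?_ h3
  linarith

lemma pow_four_le_exp {x : ℝ} (hx : 0 ≤ x) : x ^ 4 ≤ 240000 * Real.exp (x / 10) := by
  have h := Real.pow_div_factorial_le_exp (x / 10) (by positivity) 4
  rw [show (Nat.factorial 4 : ℝ) = 24 by norm_num [Nat.factorial]] at h
  have : (x / 10) ^ 4 / 24 = x ^ 4 / 240000 := by ring
  linarith

set_option maxHeartbeats 1000000 in
/-- The resilience of a random graph with `d = np` at least `log n`, with an explicit error. -/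
theorem binomialRandom_real_globalResilience_ne (p : unitInterval) {n : ℕ} {d β l : ℝ} {L C : ℕ}
    (hC : C = 64000)
    (hnV : Fintype.card V = n) (hd : d = n * p) (hl : l = 32000 * 384006) (hβ0 : 0 < β)
    (hβ1 : β ≤ 1 / 4) (hβl : Real.exp l * (192003 * β) ≤ 1) (hL : 128 / β ^ 2 ≤ L)
    (hLd : L + 1 ≤ d / 2000) (hd0 : 10 ^ 10 ≤ d) (hdβ : 48 ≤ d * β ^ 2) (hnβ : 128 ≤ n * β ^ 2)
    (hn : 4000 ≤ n) (hlogd : Real.log n ≤ d) (hlog : 160000 ≤ Real.log n)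
    (hp : (p : ℝ) ≤ (n : ℝ) ^ (-0.4 : ℝ)) :
    (binomialRandom V p).real
      {G | (G.globalResilience IsHamiltonian : ℤ) ≠ (G.minDeg : ℤ) - 1} ≤
      3 * Real.exp (-d) + 3 * Real.exp (-(d - Real.log n)) + (Real.exp (Real.exp (-d)) - 1) +
        Real.exp (-n) + 960000 * Real.exp 9 * Real.exp (-(d / 2)) := by
  have hp0 : (0 : ℝ) ≤ p := p.2.1
  have hp1 : (p : ℝ) ≤ 1 := p.2.2
  have hnpos : (0 : ℝ) < n := by
    have : 0 < n := by omega
    exact_mod_cast this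
  have hn4 : (4000 : ℝ) ≤ n := by exact_mod_cast hn
  have hnexp : (n : ℝ) ≤ Real.exp d := by rw [← Real.log_le_iff_le_exp hnpos]; exact hlogd
  have : Nonempty V := Fintype.card_pos_iff.1 (by omega)
  -- C = 64000 makes Ck nearly 16d, above 2δ ≤ 8d, and c is about k/4. Both k and L + 1 are small
  -- enough for m ≤ nd/1000, as the booster bound requires.
  set k := ⌊d / 4000⌋₊ with hk
  set c := ⌊d / 16000⌋₊ with hc
  set b := ⌊β * n⌋₊ with hb
  set m := n * (2 * k + L + 1) with hm
  have hk1 : (k : ℝ) ≤ d / 4000 := Nat.floor_le (by linarith)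
  have hk2 : d / 4000 - 1 < k := Nat.sub_one_lt_floor _
  have hc1 : (c : ℝ) ≤ d / 16000 := Nat.floor_le (by linarith)
  have hc2 : d / 16000 < c + 1 := Nat.lt_floor_add_one _
  have hb1 : (b : ℝ) ≤ β * n := Nat.floor_le (by positivity)
  have hb2 : β * n - 1 < b := Nat.sub_one_lt_floor _
  have hb3 : β * n / 2 ≤ b := by
    have : n * β * β ≤ n * β * (1 / 4) := by gcongr
    linarith
  have hm1 : (m : ℝ) ≤ n * d / 1000 := by
    rw [hm]
    push_cast
    have : (2 * k + L + 1 : ℝ) ≤ d / 1000 := by linarith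
    calc (n : ℝ) * (2 * k + L + 1) ≤ n * (d / 1000) := by gcongr
      _ = _ := by ring
  have hnd : 4000 * d ≤ n * d := mul_le_mul_of_nonneg_right hn4 (by linarith)
  have hnd0 : 0 ≤ n * d := mul_nonneg hnpos.le (by linarith)
  -- the exceptional events
  set E₁ : Set (SimpleGraph V) := {G | 2 * (Fintype.card V * (Fintype.card V * p : ℝ)) <
      G.edgeSet.ncard} with hE₁
  set E₂ : Set (SimpleGraph V) := {G | G.minDeg = 0} with hE₂
  set E₃ : Set (SimpleGraph V) := {G | ∃ X : Finset V, X.card ≤ (3 * C + 3) * b ∧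
      k * X.card < 2 * (3 * C + 3) * (G.edgesIn (innerPairs X)).card} with hE₃
  set E₄ : Set (SimpleGraph V) := {G | ∃ A B : Finset V, Disjoint A B ∧ b ≤ A.card ∧ b ≤ B.card ∧
      ((G.edgesIn (crossPairs A B)).card : ℝ) ≤ n * d * β ^ 2 / 16} with hE₄
  set E₅ : Set (SimpleGraph V) := {G | ∃ u v, u ≠ v ∧ c < (G.nbrs u ∩ G.nbrs v).card} with hE₅
  set E₆ : Set (SimpleGraph V) := {G | ∃ u v, u ≠ v ∧ (G.nbrs u).card < 4 * k ∧
      (G.nbrs v).card < 4 * k ∧ ∃ w : G.Walk u v, w.length ≤ 4} with hE₆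
  set E₇ : Set (SimpleGraph V) := {G | ∃ Γ ≤ G, Γ.edgeSet.ncard ≤ m ∧
      Fintype.card V ^ 2 ≤ 32 * Γ.boosters.card ∧
      ((G.edgesIn Γ.boosters).card : ℝ) ≤ 4 * d} with hE₇
  have hgood : {G : SimpleGraph V | (G.globalResilience IsHamiltonian : ℤ) ≠ (G.minDeg : ℤ) - 1} ⊆
      E₁ ∪ E₂ ∪ E₃ ∪ E₄ ∪ E₅ ∪ E₆ ∪ E₇ := by
    intro G hG
    by_contra hcon
    simp only [Set.mem_union, not_or] at hcon
    obtain ⟨⟨⟨⟨⟨⟨h1, h2⟩, h3⟩, h4⟩, h5⟩, h6⟩, h7⟩ := hcon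
    rw [hE₁, Set.mem_ofPred, not_lt, hnV, ← hd] at h1
    have hδ : (G.minDeg : ℝ) ≤ 4 * d := minDeg_le_of_card_edges (by rw [hnV]; exact h1)
    -- Half of the joining threshold ndβ²/16 absorbs δ ≤ 4d, since nβ² ≥ 128; the other half is M.
    have hres : G.IsResilientlyHamiltonian k C b c m (n * d * β ^ 2 / 32) (2 * (n * d)) := by
      refine ⟨?_, ?_, h1, ?_, ?_, ?_, ?_⟩
      · have : (2 * G.minDeg : ℝ) ≤ C * k := by rw [hC]; push_cast; linarith
        exact_mod_cast this
      · intro X hX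
        by_contra hlt
        exact h3 ⟨X, hX, not_le.1 hlt⟩
      · intro A B hAB hA hB
        by_contra hlt
        refine h4 ⟨A, B, hAB, hA, hB, (not_le.1 hlt).le.trans ?_⟩
        have := mul_le_mul_of_nonneg_right hnβ (show 0 ≤ d by linarith)
        linarith
      · intro u v huv
        by_contra hlt
        exact h5 ⟨u, v, huv, not_le.1 hlt⟩
      · intro u v huv hu hv w
        by_contra hlt
        exact h6 ⟨u, v, huv, hu, hv, w, not_lt.1 hlt⟩
      · intro Γ hΓ hΓm hΓB
        by_contra hlt
        refine h7 ⟨Γ, hΓ, hΓm, hΓB, ?_⟩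
        have : ((G.edgesIn Γ.boosters).card : ℝ) ≤ G.minDeg := by exact_mod_cast (not_le.1 hlt).le
        linarith
    refine hG (globalResilience_isHamiltonian_eq (by omega) (Nat.one_le_iff_ne_zero.2 h2) ?_)
    intro H _ hH
    refine hres.isHamiltonian_sdiff (L := L) ?_ (by omega) ?_ (by omega) ?_ ?_ ?_ ?_
      (by rw [hnV]) hH
    · have : (0 : ℝ) < k := by linarith
      exact_mod_cast this
    · have : (4 * b : ℝ) ≤ n := by
        have := mul_le_mul_of_nonneg_right hβ1 hnpos.le
        linarith
      rw [hnV]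
      exact_mod_cast this
    · have : (c + 3 * C : ℝ) ≤ k := by rw [hC]; push_cast; linarith
      exact_mod_cast this
    · have : 0 < d := by linarith
      positivity
    · have h8 : β ^ 2 ≤ 1 := pow_le_one₀ hβ0.le (by linarith)
      have := mul_le_mul_of_nonneg_left h8 hnd0
      linarith
    · rw [div_le_iff₀ (by positivity)] at hL
      have := mul_le_mul_of_nonneg_left hL hnd0
      linarith
  have b1 : (binomialRandom V p).real E₁ ≤ Real.exp (-d) := by
    refine (binomialRandom_real_many_edges p).trans (Real.exp_le_exp.2 ?_)
    rw [hnV, ← hd]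
    linarith
  have b2 : (binomialRandom V p).real E₂ ≤ 3 * Real.exp (-(d - Real.log n)) := by
    refine (binomialRandom_real_minDeg_eq_zero p).trans ?_
    rw [hnV]
    have h1 : (n : ℝ) * Real.exp (-(p * (n - 1))) = Real.exp p * Real.exp (-(d - Real.log n)) := by
      conv_lhs => rw [← Real.exp_log hnpos]
      rw [← Real.exp_add, ← Real.exp_add, Real.exp_log hnpos, hd]
      ring_nf
    rw [h1]
    have h2 : Real.exp p ≤ 3 :=
      (Real.exp_le_exp.2 hp1).trans (by linarith [Real.exp_one_lt_d9])
    gcongr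
  have b3 : (binomialRandom V p).real E₃ ≤ Real.exp (Real.exp (-d)) - 1 := by
    -- Here 2(3C + 3) = 384006, so `l` turns the tail term into 32000 k, almost 8d, while β keeps
    -- the moment term below d.
    have h := binomialRandom_real_not_sparse (V := V) p (k := k) (q := 2 * (3 * C + 3))
      (B₀ := (3 * C + 3) * b) (by omega) (l := l) (z := 2 * d) (by rw [hl]; norm_num) (by
        have h1 : (Real.exp l - 1) * p * ((3 * C + 3) * b : ℕ) ≤ d := by
          rw [hC]
          push_cast
          calc (Real.exp l - 1) * p * (192003 * b) ≤ Real.exp l * p * (192003 * (β * n)) := by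
                gcongr
                linarith
            _ = (Real.exp l * (192003 * β)) * d := by rw [hd]; ring
            _ ≤ 1 * d := by gcongr
            _ = d := one_mul d
        have h2 : l * (k / (2 * (3 * C + 3) : ℕ)) = 32000 * k := by
          rw [hl, hC]; push_cast; ring
        rw [h2]
        linarith)
    refine h.trans (sub_le_sub_right (Real.exp_le_exp.2 ?_) 1)
    rw [hnV]
    calc Real.exp (-(2 * d)) * n ≤ Real.exp (-(2 * d)) * Real.exp d := by gcongr
      _ = Real.exp (-d) := by rw [← Real.exp_add]; ring_nf
  have b4 : (binomialRandom V p).real E₄ ≤ Real.exp (-n) := by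
    refine (binomialRandom_real_not_join p b _).trans ?_
    rw [hnV]
    have h1 : (4 : ℝ) ≤ Real.exp 2 := by
      have h := Real.exp_one_gt_d9
      have : Real.exp 2 = Real.exp 1 * Real.exp 1 := by rw [← Real.exp_add]; norm_num
      nlinarith
    have h2 : (4 : ℝ) ^ n ≤ Real.exp (n * 2) := by
      rw [Real.exp_nat_mul]
      exact pow_le_pow_left₀ (by norm_num) h1 n
    have h3 : n * d * β ^ 2 / 8 ≤ p * (b : ℝ) ^ 2 / 2 := by
      have : (β * n / 2) ^ 2 ≤ (b : ℝ) ^ 2 := pow_le_pow_left₀ (by positivity) hb3 2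
      calc n * d * β ^ 2 / 8 = p * (β * n / 2) ^ 2 / 2 := by rw [hd]; ring
        _ ≤ p * (b : ℝ) ^ 2 / 2 := by gcongr
    calc (4 : ℝ) ^ n * Real.exp (n * d * β ^ 2 / 16 - p * b ^ 2 / 2)
        ≤ Real.exp (n * 2) * Real.exp (n * d * β ^ 2 / 16 - p * b ^ 2 / 2) := by gcongr
      _ ≤ Real.exp (-n) := by
        rw [← Real.exp_add, Real.exp_le_exp]
        have : (n : ℝ) * 48 ≤ n * (d * β ^ 2) := by gcongr
        linarith
  have b5 : (binomialRandom V p).real E₅ ≤ Real.exp (-d) := by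
    refine (binomialRandom_real_codeg p c).trans ?_
    rw [hnV]
    -- p ≤ n^(-0.4), c + 1 > d/16000 and log n ≥ 160000 multiply to the exponent -4d, which beats n²
    -- e^d ≤ e^(3d).
    have h1 : (p : ℝ) ^ (c + 1) ≤ Real.exp (-(4 * d)) := by
      calc (p : ℝ) ^ (c + 1) ≤ ((n : ℝ) ^ (-0.4 : ℝ)) ^ (c + 1) := by gcongr
        _ = Real.exp ((c + 1 : ℕ) * (Real.log n * (-0.4))) := by
            rw [Real.rpow_def_of_pos hnpos, ← Real.exp_nat_mul]
        _ ≤ Real.exp (-(4 * d)) := by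
            rw [Real.exp_le_exp]
            push_cast
            have : 160000 * (d / 16000) ≤ Real.log n * (c + 1) :=
              mul_le_mul hlog hc2.le (by linarith) (by linarith)
            linarith
    have h2 : (n : ℝ) ^ 2 ≤ Real.exp (2 * d) := by
      have : Real.exp (2 * d) = Real.exp d ^ 2 := by rw [← Real.exp_nat_mul]; norm_num
      rw [this]
      gcongr
    calc (n : ℝ) ^ 2 * ((p : ℝ) ^ (c + 1) * Real.exp (p * n))
        ≤ Real.exp (2 * d) * (Real.exp (-(4 * d)) * Real.exp d) := by
          rw [mul_comm (p : ℝ) n, ← hd]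
          gcongr
      _ = Real.exp (-d) := by rw [← Real.exp_add, ← Real.exp_add]; ring_nf
  have b6 : (binomialRandom V p).real E₆ ≤ 960000 * Real.exp 9 * Real.exp (-(d / 2)) := by
    refine (binomialRandom_real_small_near p k (by rw [hnV, ← hd]; linarith)).trans ?_
    rw [hnV, ← hd]
    have h1 : d ^ 4 ≤ 240000 * Real.exp (d / 10) := pow_four_le_exp (by linarith)
    have h2 : 24 * k - 1.8 * d + 9 ≤ 9 - 1.7 * d := by linarith
    calc 4 * (n * (d ^ 4 * Real.exp (24 * k - 1.8 * d + 9)))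
        ≤ 4 * (Real.exp d * (240000 * Real.exp (d / 10) * Real.exp (9 - 1.7 * d))) := by gcongr
      _ = 960000 * (Real.exp d * Real.exp (d / 10) * Real.exp (9 - 1.7 * d)) := by ring
      _ = 960000 * (Real.exp 9 * Real.exp (-(d * 0.6))) := by
          rw [← Real.exp_add, ← Real.exp_add, ← Real.exp_add]; ring_nf
      _ ≤ 960000 * (Real.exp 9 * Real.exp (-(d / 2))) := by
          gcongr
          linarith
      _ = _ := by ring
  have b7 : (binomialRandom V p).real E₇ ≤ Real.exp (-d) := by
    refine (binomialRandom_real_few_boosters p m (4 * d)).trans (Real.exp_le_exp.2 ?_)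
    rw [hnV]
    have : p * (n : ℝ) ^ 2 / 100 = n * d / 100 := by rw [hd]; ring
    rw [this]
    linarith
  have hunion := measureReal_mono (μ := binomialRandom V p) hgood (measure_ne_top _ _)
  have u1 := measureReal_union_le (μ := binomialRandom V p) (E₁ ∪ E₂ ∪ E₃ ∪ E₄ ∪ E₅ ∪ E₆) E₇
  have u2 := measureReal_union_le (μ := binomialRandom V p) (E₁ ∪ E₂ ∪ E₃ ∪ E₄ ∪ E₅) E₆
  have u3 := measureReal_union_le (μ := binomialRandom V p) (E₁ ∪ E₂ ∪ E₃ ∪ E₄) E₅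
  have u4 := measureReal_union_le (μ := binomialRandom V p) (E₁ ∪ E₂ ∪ E₃) E₄
  have u5 := measureReal_union_le (μ := binomialRandom V p) (E₁ ∪ E₂) E₃
  have u6 := measureReal_union_le (μ := binomialRandom V p) E₁ E₂
  linarith

end Resilience

end SimpleGraph

/-! ### Passage to the limit. -/

open SimpleGraph MeasureTheory in
theorem theorem3 (p : ℕ → unitInterval)
    (hlow : Tendsto
      (fun n : ℕ => (n : ℝ) * (p n : ℝ) - Real.log (n : ℝ) - Real.log (Real.log (n : ℝ)))
      atTop atTop)
    (hup : ∀ᶠ n : ℕ in atTop, (p n : ℝ) ≤ (n : ℝ) ^ (-0.4 : ℝ)) :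
    Tendsto
      (fun n : ℕ => SimpleGraph.binomialRandom (Fin n) (p n)
        {G : SimpleGraph (Fin n) |
          (G.globalResilience SimpleGraph.IsHamiltonian : ℤ) = (G.minDeg : ℤ) - 1})
      atTop (𝓝 1) := by
  have hcast : Tendsto (fun n : ℕ => (n : ℝ)) atTop atTop := tendsto_natCast_atTop_atTop
  have hlogt : Tendsto (fun n : ℕ => Real.log n) atTop atTop := Real.tendsto_log_atTop.comp hcast
  set d : ℕ → ℝ := fun n => n * (p n : ℝ) with hd
  have hsub : Tendsto (fun n => d n - Real.log n) atTop atTop := by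
    refine tendsto_atTop_mono' _ ?_ hlow
    filter_upwards [hlogt.eventually_ge_atTop 1] with n hn
    have := Real.log_nonneg hn
    simp only [hd]
    linarith
  have hdt : Tendsto d atTop atTop := by
    refine tendsto_atTop_mono' _ ?_ hsub
    filter_upwards [hlogt.eventually_ge_atTop 0] with n hn
    linarith
  set l : ℝ := 32000 * 384006 with hl
  -- β is absolute, with 192003 = 3C + 3, so L is too and all the size conditions hold for large n.
  set β : ℝ := 1 / (Real.exp l * 192003) with hβ
  have hβ0 : 0 < β := by positivity
  have hβ1 : β ≤ 1 / 4 := by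
    have : 1 ≤ Real.exp l := Real.one_le_exp (by rw [hl]; norm_num)
    exact one_div_le_one_div_of_le (by norm_num) (by linarith)
  have hβl : Real.exp l * (192003 * β) ≤ 1 := by
    rw [hβ]
    field_simp
    exact le_rfl
  set L := ⌈128 / β ^ 2⌉₊ with hL
  set F : ℕ → ℝ := fun n => 3 * Real.exp (-d n) + 3 * Real.exp (-(d n - Real.log n)) +
    (Real.exp (Real.exp (-d n)) - 1) + Real.exp (-n) +
    960000 * Real.exp 9 * Real.exp (-(d n / 2)) with hF
  have hF0 : Tendsto F atTop (𝓝 0) := by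
    have e1 : Tendsto (fun n => Real.exp (-d n)) atTop (𝓝 0) :=
      Real.tendsto_exp_neg_atTop_nhds_zero.comp hdt
    have e2 : Tendsto (fun n => Real.exp (-(d n - Real.log n))) atTop (𝓝 0) :=
      Real.tendsto_exp_neg_atTop_nhds_zero.comp hsub
    have e3 : Tendsto (fun n => Real.exp (Real.exp (-d n)) - 1) atTop (𝓝 0) := by
      have := ((Real.continuous_exp.tendsto 0).comp e1).sub_const 1
      simpa using this
    have e4 : Tendsto (fun n : ℕ => Real.exp (-(n : ℝ))) atTop (𝓝 0) :=
      Real.tendsto_exp_neg_atTop_nhds_zero.comp hcast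
    have e5 : Tendsto (fun n => Real.exp (-(d n / 2))) atTop (𝓝 0) :=
      Real.tendsto_exp_neg_atTop_nhds_zero.comp (hdt.atTop_div_const (by norm_num))
    have := ((((e1.const_mul 3).add (e2.const_mul 3)).add e3).add e4).add
      (e5.const_mul (960000 * Real.exp 9))
    simpa only [hF, mul_zero, add_zero] using this
  have hbound : ∀ᶠ n in atTop, (binomialRandom (Fin n) (p n)).real
      {G | (G.globalResilience IsHamiltonian : ℤ) ≠ (G.minDeg : ℤ) - 1} ≤ F n := by
    filter_upwards [hup, hsub.eventually_ge_atTop 0, hdt.eventually_ge_atTop (10 ^ 10),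
      hdt.eventually_ge_atTop (2000 * (L + 1)), hdt.eventually_ge_atTop (48 / β ^ 2),
      hcast.eventually_ge_atTop (128 / β ^ 2), eventually_ge_atTop 4000,
      hlogt.eventually_ge_atTop 160000] with n h1 h2 h3 h4 h5 h6 h7 h8
    refine binomialRandom_real_globalResilience_ne (V := Fin n) (p n) (L := L) (β := β) (l := l)
      rfl (by simp) rfl rfl hβ0 hβ1 hβl (Nat.le_ceil _) (by linarith) h3 ?_ ?_ h7 (by linarith) h8 h1
    · rwa [div_le_iff₀ (by positivity)] at h5
    · rwa [div_le_iff₀ (by positivity)] at h6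
  have hlim : Tendsto (fun n => 1 - ENNReal.ofReal (F n)) atTop (𝓝 1) := by
    have := ENNReal.Tendsto.sub (tendsto_const_nhds (x := (1 : ENNReal)) (f := atTop))
      (ENNReal.tendsto_ofReal hF0) (Or.inl ENNReal.one_ne_top)
    simpa using this
  refine tendsto_of_tendsto_of_tendsto_of_le_of_le' hlim tendsto_const_nhds ?_
    (Eventually.of_forall fun n => prob_le_one)
  filter_upwards [hbound] with n hn
  rw [tsub_le_iff_right]
  set S := {G : SimpleGraph (Fin n) | (G.globalResilience IsHamiltonian : ℤ) = (G.minDeg : ℤ) - 1}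
    with hS
  calc (1 : ENNReal) = binomialRandom (Fin n) (p n) Set.univ := measure_univ.symm
    _ = binomialRandom (Fin n) (p n) (S ∪ Sᶜ) := by rw [Set.union_compl_self]
    _ ≤ binomialRandom (Fin n) (p n) S + binomialRandom (Fin n) (p n) Sᶜ := measure_union_le _ _
    _ ≤ _ := by
      gcongr
      rw [← ofReal_measureReal]
      exact ENNReal.ofReal_le_ofReal hn
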